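/- **Setting.** Observe $O=(Z,A,Y,L)\in\mathcal Z\times\{0,1\}\times\mathcal Y\times\mathcal L$, where $\mathcal Z,\mathcal L$ are standard Borel spaces (e.g. Borel subsets of Euclidean spaces) and $\mathcal Y\subseteq\mathbb R$ is Borel: an instrument $Z$, a binary treatment $A$, an outcome $Y$ and covariates $L$. Let $P$ be the law of $O$, with $E_P[Y^2]<\infty$ and otherwise unrestricted. Let $\pi:\mathcal Z\times\mathcal L\to\mathbb R$ be a fixed regular weighting function for $A$ under $P$: $\pi$ is measurable and uniformly bounded, and there is $\epsilon_0>0$ such that $|\mathrm{Cov}_P\{I\{A=a\},\pi(Z,L)\mid L\}|\ge\epsilon_0$ almost surely for each $a\in\{0,1\}$. Put $$\delta^o(L)=E_P[A\mid L],\quad \eta^o(L)=E_P[Y\mid L],\quad \rho_\pi^o(L)=E_P[\pi(Z,L)\mid L],$$ $$\kappa_\pi^o(L)=\mathrm{Cov}_P\{A,\pi(Z,L)\mid L\},\quad \gamma_\pi^o(L)=\frac{\mathrm{Cov}_P\{Y,\pi(Z,L)\mid L\}}{\mathrm{Cov}_P\{A,\pi(Z,L)\mid L\}},\quad \alpha_\pi^o=(\delta^o,\kappa_\pi^o,\rho_\pi^o,\eta^o,\gamma_\pi^o),$$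 and consider the functional $\psi_\pi(P)=E_P[\gamma_\pi^o(L)]$, with value $\psi_\pi^o$ at $P$. For $\alpha=(\delta,\kappa,\rho,\eta,\gamma)$ let $$\varphi_\pi(O;\psi,\alpha)=\frac{1}{\kappa(L)}\{\pi(Z,L)-\rho(L)\}\{Y-\eta(L)\}-\psi+\left(1-\frac{\{\pi(Z,L)-\rho(L)\}\{A-\delta(L)\}}{\kappa(L)}\right)\gamma(L).$$ **Model.** The nonparametric model consists of all laws $Q$ of $O$ with $E_Q[Y^2]<\infty$ for which $|\mathrm{Cov}_Q\{I\{A=a\},\pi(Z,L)\mid L\}|$ is $Q$-almost surely bounded below by a positive constant for each $a$. A regular parametric submodel through $P$ with score $s\in L_2(P)$ is a one-dimensional family $(P_\theta)_{\theta\in\mathbb R}$, $P_0=P$, with densities $p_\theta$ with respect to some $\sigma$-finite measure $\mu$, such that $$\int\left(\frac{\sqrt{p_\theta}-\sqrt{p_0}}{\theta}-\frac12 s\sqrt{p_0}\right)^2d\mu\to0\quad(\theta\to0),$$ and such that, for some constants $K<\infty$, $\epsilon>0$ and all $\theta$ in a neighbourhood of $0$, $E_{P_\theta}[Y^2]\le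 K^2$ and $|\mathrm{Cov}_{P_\theta}\{I\{A=a\},\pi(Z,L)\mid L\}|\ge\epsilon$ $P_\theta$-almost surely for each $a$. The tangent space is the closed linear span in $L_2(P)$ of the scores of all regular parametric submodels. An influence function of $\psi_\pi$ at $P$ is a $\varphi\in L_2(P)$ with $E_P[\varphi]=0$ such that, for every regular parametric submodel, $\theta\mapsto\psi_\pi(P_\theta)$ is differentiable at $0$ with derivative $E_P[\varphi s]$. The efficient influence function (EIF) is the influence function that belongs to the tangent space. **Theorem.** The EIF of $\psi_\pi$ at $P$ is $\varphi_\pi(O;\psi_\pi^o,\alpha_\pi^o)$. Moreover, it is the only influence function of $\psi_\pi$ at $P$, up to $P$-almost sure equality. -/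

import Mathlib

open MeasureTheory ProbabilityTheory Filter Topology
open scoped NNReal ENNReal

noncomputable section

namespace Semiparametric

variable {X : Type*} [MeasurableSpace X]

/-- A one-dimensional parametric submodel `θ ↦ Pt θ` through `P = Pt 0`, dominated by a σ-finite
measure with densities `p θ`, which is differentiable in quadratic mean at `θ = 0` with score
`s` (the generalization of `s = ∂/∂θ log p θ` at `θ = 0`). -/
structure IsQMDPath (P : ProbabilityMeasure X) (Pt : ℝ → ProbabilityMeasure X) (s : X → ℝ) :
    Prop where
  at_zero : Pt 0 = P
  score_memLp : MemLp s 2 (P : Measure X)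
  differentiable : ∃ μ : Measure X, SigmaFinite μ ∧ ∃ p : ℝ → X → ℝ,
    (∀ θ, Measurable (p θ)) ∧ (∀ θ x, 0 ≤ p θ x) ∧
    (∀ θ, (Pt θ : Measure X) = μ.withDensity (fun x => ENNReal.ofReal (p θ x))) ∧
    Tendsto
      (fun θ : ℝ => eLpNorm
        (fun x => (√(p θ x) - √(p 0 x)) / θ - s x * √(p 0 x) / 2) 2 μ)
      (𝓝[≠] 0) (𝓝 0)

/-- The tangent space at `P`: the closed linear span in `L²(P)` of the scores of the admissible
submodels. The predicate `Sub Pt s` says that `Pt` is an admissible submodel through `P`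
with score `s`. -/
def tangentSpace (P : ProbabilityMeasure X)
    (Sub : (ℝ → ProbabilityMeasure X) → (X → ℝ) → Prop) :
    Submodule ℝ (Lp ℝ 2 (P : Measure X)) :=
  (Submodule.span ℝ
    {g : Lp ℝ 2 (P : Measure X) | ∃ Pt s, Sub Pt s ∧ g =ᵐ[(P : Measure X)] s}).topologicalClosure

/-- `φ` is an influence function (gradient) at `P` of the functional `Ψ`: it is square integrable
with mean zero, and along each admissible submodel `Ψ` is differentiable at `θ = 0` with
derivative `E_P[φ s]`. -/
structure IsInfluenceFunction (P : ProbabilityMeasure X)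
    (Sub : (ℝ → ProbabilityMeasure X) → (X → ℝ) → Prop)
    (Ψ : ProbabilityMeasure X → ℝ) (φ : X → ℝ) : Prop where
  memLp : MemLp φ 2 (P : Measure X)
  mean_zero : ∫ x, φ x ∂(P : Measure X) = 0
  hasDerivAt : ∀ Pt s, Sub Pt s →
    HasDerivAt (fun θ : ℝ => Ψ (Pt θ)) (∫ x, φ x * s x ∂(P : Measure X)) 0

/-- The efficient influence function (canonical gradient): the influence function that lies in
the tangent space. -/
def IsEfficientInfluenceFunction (P : ProbabilityMeasure X)
    (Sub : (ℝ → ProbabilityMeasure X) → (X → ℝ) → Prop)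
    (Ψ : ProbabilityMeasure X → ℝ) (φ : X → ℝ) : Prop :=
  ∃ h : IsInfluenceFunction P Sub Ψ φ, h.memLp.toLp φ ∈ tangentSpace P Sub

end Semiparametric

namespace IV

/-- The observed data `O = (Z, A, Y, L)`: instrument, binary treatment, real outcome with range
in `𝒴`, covariates. -/
abbrev Obs (𝒵 : Type*) (𝒴 : Set ℝ) (𝓛 : Type*) : Type _ := 𝒵 × Fin 2 × 𝒴 × 𝓛

variable {𝒵 : Type*} {𝒴 : Set ℝ} {𝓛 : Type*}

namespace Obs

/-- The instrument. -/
def Z (o : Obs 𝒵 𝒴 𝓛) : 𝒵 := o.1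
/-- The binary treatment, as the real number `0` or `1`. -/
def A (o : Obs 𝒵 𝒴 𝓛) : ℝ := ((o.2.1 : ℕ) : ℝ)
/-- The indicator `I{A = a}`. -/
def indA (a : Fin 2) (o : Obs 𝒵 𝒴 𝓛) : ℝ := if o.2.1 = a then 1 else 0
/-- The outcome. -/
def Y (o : Obs 𝒵 𝒴 𝓛) : ℝ := (o.2.2.1 : ℝ)
/-- The covariates. -/
def L (o : Obs 𝒵 𝒴 𝓛) : 𝓛 := o.2.2.2

end Obs

/-- The random variable `π(Z, L)`. -/
def wt (π : 𝒵 → 𝓛 → ℝ) (o : Obs 𝒵 𝒴 𝓛) : ℝ := π o.Z o.L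

variable [MeasurableSpace 𝒵] [StandardBorelSpace 𝒵] [Nonempty 𝒵]
  [StandardBorelSpace 𝒴] [Nonempty 𝒴]
  [MeasurableSpace 𝓛] [StandardBorelSpace 𝓛] [Nonempty 𝓛]

/-- The conditional law of `O` given `L = l` under `P`. -/
def condLaw (P : ProbabilityMeasure (Obs 𝒵 𝒴 𝓛)) (l : 𝓛) : Measure (Obs 𝒵 𝒴 𝓛) :=
  condDistrib (fun o : Obs 𝒵 𝒴 𝓛 => o) Obs.L (P : Measure (Obs 𝒵 𝒴 𝓛)) l

/-- The marginal law of `L` under `P`. -/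
def lawL (P : ProbabilityMeasure (Obs 𝒵 𝒴 𝓛)) : Measure 𝓛 :=
  (P : Measure (Obs 𝒵 𝒴 𝓛)).map Obs.L

/-- `E_P[f(O) | L = l]`. -/
def condMean (P : ProbabilityMeasure (Obs 𝒵 𝒴 𝓛)) (f : Obs 𝒵 𝒴 𝓛 → ℝ) (l : 𝓛) : ℝ :=
  ∫ o, f o ∂(condLaw P l)

/-- `Cov_P{f(O), g(O) | L = l}`. -/
def condCov (P : ProbabilityMeasure (Obs 𝒵 𝒴 𝓛)) (f g : Obs 𝒵 𝒴 𝓛 → ℝ) (l : 𝓛) : ℝ :=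
  covariance f g (condLaw P l)

/-- `|Cov{I{A = a}, π(Z, L) | L}| ≥ ε` almost surely under `P`, for every treatment level `a`. -/
def RelevanceBound (π : 𝒵 → 𝓛 → ℝ) (ε : ℝ) (P : ProbabilityMeasure (Obs 𝒵 𝒴 𝓛)) : Prop :=
  ∀ a : Fin 2, ∀ᵐ l ∂(lawL P), ε ≤ |condCov P (Obs.indA a) (wt π) l|

/-- `π(Z, L)` is a regular weighting function for `A` under `P`. -/
structure IsRWF (P : ProbabilityMeasure (Obs 𝒵 𝒴 𝓛)) (π : 𝒵 → 𝓛 → ℝ) : Prop where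
  measurable : Measurable (Function.uncurry π)
  bounded : ∃ C : ℝ, ∀ z l, |π z l| ≤ C
  relevance : ∃ ε : ℝ, 0 < ε ∧ RelevanceBound π ε P

/-- A vector `α = (δ, κ, ρ, η, γ)` of nuisance functions of `L`. -/
structure Nuisance (𝓛 : Type*) where
  δ : 𝓛 → ℝ
  κ : 𝓛 → ℝ
  ρ : 𝓛 → ℝ
  η : 𝓛 → ℝ
  γ : 𝓛 → ℝ

/-- The true nuisance functions under `P`. -/
def trueNuisance (π : 𝒵 → 𝓛 → ℝ) (P : ProbabilityMeasure (Obs 𝒵 𝒴 𝓛)) : Nuisance 𝓛 where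
  δ := condMean P Obs.A
  κ := condCov P Obs.A (wt π)
  ρ := condMean P (wt π)
  η := condMean P Obs.Y
  γ := fun l => condCov P Obs.Y (wt π) l / condCov P Obs.A (wt π) l

/-- The functional `ψ_π(P) = E_P[Cov_P{Y, π(Z, L) | L} / Cov_P{A, π(Z, L) | L}]`. -/
def psi (π : 𝒵 → 𝓛 → ℝ) (P : ProbabilityMeasure (Obs 𝒵 𝒴 𝓛)) : ℝ :=
  ∫ o, condCov P Obs.Y (wt π) o.L / condCov P Obs.A (wt π) o.L ∂(P : Measure (Obs 𝒵 𝒴 𝓛))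

/-- `φ_π(O; ψ, α)`. -/
def phi (π : 𝒵 → 𝓛 → ℝ) (ψ : ℝ) (α : Nuisance 𝓛) (o : Obs 𝒵 𝒴 𝓛) : ℝ :=
  1 / α.κ o.L * (π o.Z o.L - α.ρ o.L) * (o.Y - α.η o.L) - ψ
    + (1 - (π o.Z o.L - α.ρ o.L) * (o.A - α.δ o.L) / α.κ o.L) * α.γ o.L

/-- The laws of `O`, otherwise unrestricted, with `E_P[Y²] ≤ K²` and relevance bound `ε`.
The nonparametric model for a fixed weighting function `π` is the union of these sets over all
`K` and all `ε > 0`. -/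
def boundedModel (π : 𝒵 → 𝓛 → ℝ) (K : ℝ≥0) (ε : ℝ) : Set (ProbabilityMeasure (Obs 𝒵 𝒴 𝓛)) :=
  {P | eLpNorm Obs.Y 2 (P : Measure (Obs 𝒵 𝒴 𝓛)) ≤ K ∧ RelevanceBound π ε P}

/-- A regular parametric submodel of the nonparametric model through `P` with score `s`:
differentiable in quadratic mean at `θ = 0`, and for `θ` near `0` its members satisfy the
model's second-moment and relevance conditions with constants that do not depend on `θ`. -/
def IsRegularSubmodel (π : 𝒵 → 𝓛 → ℝ) (P : ProbabilityMeasure (Obs 𝒵 𝒴 𝓛))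
    (Pt : ℝ → ProbabilityMeasure (Obs 𝒵 𝒴 𝓛)) (s : Obs 𝒵 𝒴 𝓛 → ℝ) : Prop :=
  Semiparametric.IsQMDPath P Pt s ∧
    ∃ (K : ℝ≥0) (ε : ℝ), 0 < ε ∧ ∀ᶠ θ in 𝓝 (0 : ℝ), Pt θ ∈ boundedModel π K ε

end IV

end

noncomputable section

namespace Semiparametric

section Hellinger

variable {X : Type*} [MeasurableSpace X]

/-- The measure with real density `p` with respect to `μ`. -/
def densMeasure (μ : Measure X) (p : X → ℝ) : Measure X :=
  μ.withDensity (fun x => ENNReal.ofReal (p x))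

variable {μ : Measure X} {p q : X → ℝ}

theorem eLpNorm_two_densMeasure (hp : Measurable p) (hp0 : ∀ x, 0 ≤ p x) (f : X → ℝ) :
    eLpNorm f 2 (densMeasure μ p) = eLpNorm (fun x => f x * √(p x)) 2 μ := by
  rw [eLpNorm_eq_lintegral_rpow_enorm_toReal (by norm_num) (by norm_num),
    eLpNorm_eq_lintegral_rpow_enorm_toReal (by norm_num) (by norm_num), densMeasure,
    lintegral_withDensity_eq_lintegral_mul_non_measurable _ (by fun_prop) (by simp)]
  congr 1
  refine lintegral_congr fun x => ?_
  have h : ‖√(p x)‖ₑ ^ (2 : ℝ) = ENNReal.ofReal (p x) := by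
    rw [Real.enorm_eq_ofReal (Real.sqrt_nonneg _),
      ENNReal.ofReal_rpow_of_nonneg (Real.sqrt_nonneg _) (by norm_num)]
    congr 1
    rw [Real.rpow_two, Real.sq_sqrt (hp0 x)]
  simp only [Pi.mul_apply, ENNReal.toReal_ofNat, enorm_mul]
  rw [ENNReal.mul_rpow_of_nonneg _ _ (by norm_num), h, mul_comm]

theorem integral_densMeasure (hp : Measurable p) (hp0 : ∀ x, 0 ≤ p x) (f : X → ℝ) :
    ∫ x, f x ∂(densMeasure μ p) = ∫ x, f x * p x ∂μ := by
  rw [densMeasure, integral_withDensity_eq_integral_toReal_smul (by fun_prop) (by simp)]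
  refine integral_congr_ae (.of_forall fun x => ?_)
  simp [ENNReal.toReal_ofReal (hp0 x), mul_comm]

theorem enorm_integral_mul_le {f g : X → ℝ} (hf : AEStronglyMeasurable f μ)
    (hg : AEStronglyMeasurable g μ) :
    ‖∫ x, f x * g x ∂μ‖ₑ ≤ eLpNorm f 2 μ * eLpNorm g 2 μ := by
  refine (enorm_integral_le_lintegral_enorm _).trans ?_
  rw [← eLpNorm_one_eq_lintegral_enorm]
  change eLpNorm (f • g) 1 μ ≤ _
  exact eLpNorm_smul_le_mul_eLpNorm hg hf

theorem tendsto_integral_mul_of_tendsto_ae [IsFiniteMeasure μ] {F : ℕ → X → ℝ} {G s : X → ℝ}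
    {C : ℝ≥0} (hF : ∀ n, AEStronglyMeasurable (F n) μ) (hFC : ∀ n, eLpNorm (F n) 2 μ ≤ C)
    (hG : MemLp G 2 μ) (hs : MemLp s 2 μ)
    (hFG : ∀ᵐ x ∂μ, Tendsto (fun n => F n x) atTop (𝓝 (G x))) :
    Tendsto (fun n => ∫ x, F n x * s x ∂μ) atTop (𝓝 (∫ x, G x * s x ∂μ)) := by
  have hFL : ∀ n, MemLp (F n) 2 μ := fun n => ⟨hF n, (hFC n).trans_lt (by simp)⟩
  have hGs : Integrable (fun x => G x * s x) μ := hG.integrable_mul hs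
  refine tendsto_integral_of_L1' _ hGs.1 (.of_forall fun n => (hFL n).integrable_mul hs) ?_
  refine tendsto_Lp_finite_of_tendsto_ae (f := fun n x => F n x * s x) le_rfl (by simp)
    (fun n => (hF n).mul hs.1) (memLp_one_iff_integrable.2 hGs) ?_ ?_
  · intro ε hε
    obtain ⟨δ, hδ, h⟩ := hs.eLpNorm_indicator_le (by norm_num) (by norm_num)
      (show 0 < ε / (C + 1) by positivity)
    refine ⟨δ, hδ, fun n S hS hSδ => ?_⟩
    have e : S.indicator (fun x => F n x * s x) = (S.indicator s) • F n := by
      ext x; by_cases hx : x ∈ S <;> simp [hx, mul_comm]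
    rw [e]
    refine (eLpNorm_smul_le_mul_eLpNorm (p := 2) (q := 2) (hF n) (hs.1.indicator hS)).trans ?_
    calc _ ≤ ENNReal.ofReal (ε / (C + 1)) * C := mul_le_mul' (h S hS hSδ) (hFC n)
      _ = ENNReal.ofReal (ε / (C + 1) * C) := by
          rw [ENNReal.ofReal_mul (by positivity)]; simp
      _ ≤ _ := by
          apply ENNReal.ofReal_le_ofReal
          rw [div_mul_eq_mul_div, div_le_iff₀ (by positivity)]
          nlinarith [C.2]
  · filter_upwards [hFG] with x hx using hx.mul_const _

theorem memLp_mul_sqrt (hp : Measurable p) (hp0 : ∀ x, 0 ≤ p x) {T : X → ℝ}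
    (hT : Measurable T) (h : eLpNorm T 2 (densMeasure μ p) < ∞) :
    MemLp (fun x => T x * √(p x)) 2 μ :=
  ⟨by fun_prop, by rwa [← eLpNorm_two_densMeasure hp hp0]⟩

theorem integral_densMeasure_sub (hp : Measurable p) (hp0 : ∀ x, 0 ≤ p x) (hq : Measurable q)
    (hq0 : ∀ x, 0 ≤ q x) [IsFiniteMeasure (densMeasure μ p)] [IsFiniteMeasure (densMeasure μ q)]
    {T : X → ℝ} (hT : Measurable T) (hTp : eLpNorm T 2 (densMeasure μ p) < ∞)
    (hTq : eLpNorm T 2 (densMeasure μ q) < ∞) :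
    ∫ x, T x ∂(densMeasure μ q) - ∫ x, T x ∂(densMeasure μ p) =
      ∫ x, (T x * √(q x) + T x * √(p x)) * (√(q x) - √(p x)) ∂μ := by
  have one : ∀ r : X → ℝ, Measurable r → (∀ x, 0 ≤ r x) → IsFiniteMeasure (densMeasure μ r) →
      MemLp (fun x => √(r x)) 2 μ := fun r hr hr0 _ => by
    simpa using memLp_mul_sqrt hr hr0 (measurable_const (a := (1 : ℝ)))
      ((memLp_const (μ := densMeasure μ r) (p := 2) (1 : ℝ)).2)
  have i1 : Integrable (fun x => T x * q x) μ := by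
    refine ((memLp_mul_sqrt hq hq0 hT hTq).integrable_mul (one q hq hq0 inferInstance)).congr
      (.of_forall fun x => ?_)
    simp [mul_assoc, Real.mul_self_sqrt (hq0 x)]
  have i2 : Integrable (fun x => T x * p x) μ := by
    refine ((memLp_mul_sqrt hp hp0 hT hTp).integrable_mul (one p hp hp0 inferInstance)).congr
      (.of_forall fun x => ?_)
    simp [mul_assoc, Real.mul_self_sqrt (hp0 x)]
  rw [integral_densMeasure hp hp0, integral_densMeasure hq hq0, ← integral_sub i1 i2]
  refine integral_congr_ae (.of_forall fun x => ?_)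
  have h1 := Real.mul_self_sqrt (hq0 x)
  have h2 := Real.mul_self_sqrt (hp0 x)
  simp only
  linear_combination T x * h2 - T x * h1

theorem enorm_integral_densMeasure_sub_le (hp : Measurable p) (hp0 : ∀ x, 0 ≤ p x)
    (hq : Measurable q) (hq0 : ∀ x, 0 ≤ q x) [IsFiniteMeasure (densMeasure μ p)]
    [IsFiniteMeasure (densMeasure μ q)]
    {T : X → ℝ} (hT : Measurable T) (hTp : eLpNorm T 2 (densMeasure μ p) < ∞)
    (hTq : eLpNorm T 2 (densMeasure μ q) < ∞) :
    ‖∫ x, T x ∂(densMeasure μ q) - ∫ x, T x ∂(densMeasure μ p)‖ₑ ≤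
      (eLpNorm T 2 (densMeasure μ q) + eLpNorm T 2 (densMeasure μ p)) *
        eLpNorm (fun x => √(q x) - √(p x)) 2 μ := by
  rw [integral_densMeasure_sub hp hp0 hq hq0 hT hTp hTq]
  refine (enorm_integral_mul_le (by fun_prop) (by fun_prop)).trans ?_
  gcongr
  rw [eLpNorm_two_densMeasure hp hp0, eLpNorm_two_densMeasure hq hq0]
  exact eLpNorm_add_le (by fun_prop) (by fun_prop) (by norm_num)

theorem eLpNorm_indicator_one_le_half {ν ν' : Measure X} {B : Set X} (hB : MeasurableSet B)
    (h : 4 * ν B ≤ ν' B) : eLpNorm (B.indicator (fun _ => (1 : ℝ))) 2 ν ≤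
      eLpNorm (B.indicator (fun _ => (1 : ℝ))) 2 ν' / 2 := by
  rw [eLpNorm_indicator_const hB (by norm_num) (by norm_num),
    eLpNorm_indicator_const hB (by norm_num) (by norm_num),
    ENNReal.le_div_iff_mul_le (by simp) (by simp)]
  have h4 := ENNReal.rpow_le_rpow h (z := 1 / 2) (by norm_num)
  rw [ENNReal.mul_rpow_of_nonneg _ _ (by norm_num)] at h4
  have h2 : (4 : ℝ≥0∞) ^ (1 / 2 : ℝ) = 2 := by
    rw [show (4 : ℝ≥0∞) = 2 ^ (2 : ℝ) by norm_num, ← ENNReal.rpow_mul]; norm_num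
  rw [h2] at h4
  simpa [mul_comm] using h4

/-- Differentiability in quadratic mean, along a sequence `t n → 0`. -/
structure QMDSeq (μ : Measure X) (p : ℕ → X → ℝ) (p₀ s : X → ℝ) (t : ℕ → ℝ) : Prop where
  meas : ∀ n, Measurable (p n)
  nonneg : ∀ n x, 0 ≤ p n x
  meas₀ : Measurable p₀
  nonneg₀ : ∀ x, 0 ≤ p₀ x
  fin : ∀ n, IsFiniteMeasure (densMeasure μ (p n))
  fin₀ : IsFiniteMeasure (densMeasure μ p₀)
  score_meas : Measurable s
  score_memLp : MemLp s 2 (densMeasure μ p₀)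
  ne_zero : ∀ n, t n ≠ 0
  tendsto_zero : Tendsto t atTop (𝓝 0)
  tendsto : Tendsto (fun n => eLpNorm
    (fun x => (√(p n x) - √(p₀ x)) / t n - s x * √(p₀ x) / 2) 2 μ) atTop (𝓝 0)

namespace QMDSeq

variable {P : ℕ → X → ℝ} {p₀ s : X → ℝ} {t : ℕ → ℝ}

theorem comp (h : QMDSeq μ P p₀ s t) {k : ℕ → ℕ} (hk : Tendsto k atTop atTop) :
    QMDSeq μ (P ∘ k) p₀ s (t ∘ k) where
  meas _ := h.meas _
  nonneg _ := h.nonneg _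
  meas₀ := h.meas₀
  nonneg₀ := h.nonneg₀
  fin _ := h.fin _
  fin₀ := h.fin₀
  score_meas := h.score_meas
  score_memLp := h.score_memLp
  ne_zero _ := h.ne_zero _
  tendsto_zero := h.tendsto_zero.comp hk
  tendsto := h.tendsto.comp hk

theorem tendsto_hellinger (h : QMDSeq μ P p₀ s t) :
    Tendsto (fun n => eLpNorm (fun x => √(P n x) - √(p₀ x)) 2 μ) atTop (𝓝 0) := by
  have m1 := h.meas; have m2 := h.meas₀; have m3 := h.score_meas
  have hs := memLp_mul_sqrt h.meas₀ h.nonneg₀ h.score_meas h.score_memLp.2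
  have key : ∀ n, eLpNorm (fun x => √(P n x) - √(p₀ x)) 2 μ ≤
      ‖t n‖ₑ * (eLpNorm (fun x => (√(P n x) - √(p₀ x)) / t n - s x * √(p₀ x) / 2) 2 μ +
        eLpNorm (fun x => s x * √(p₀ x) / 2) 2 μ) := fun n => by
    have e : (fun x => √(P n x) - √(p₀ x)) = t n • (fun x =>
        ((√(P n x) - √(p₀ x)) / t n - s x * √(p₀ x) / 2) + s x * √(p₀ x) / 2) := by
      ext x; simp; field_simp [h.ne_zero n]
    rw [e, eLpNorm_const_smul]
    gcongr
    exact eLpNorm_add_le (by fun_prop) (by fun_prop) (by norm_num)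
  have hfin : eLpNorm (fun x => s x * √(p₀ x) / 2) 2 μ ≠ ∞ := by
    have := (hs.mul_const (1 / 2)).2.ne
    simpa [div_eq_mul_inv] using this
  have ht : Tendsto (fun n => ‖t n‖ₑ) atTop (𝓝 0) := by
    simpa using h.tendsto_zero.enorm
  refine tendsto_of_tendsto_of_tendsto_of_le_of_le tendsto_const_nhds ?_ (fun _ => zero_le) key
  have := ENNReal.Tendsto.mul ht (Or.inr (by simpa using hfin))
    (h.tendsto.add (tendsto_const_nhds (x := eLpNorm (fun x => s x * √(p₀ x) / 2) 2 μ)))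
    (Or.inr (by simp))
  simpa using this

theorem tendsto_integral_slope (h : QMDSeq μ P p₀ s t) {T : ℕ → X → ℝ} {T₀ : X → ℝ} {C : ℝ≥0}
    (hT : ∀ n, Measurable (T n)) (hTP : ∀ n, eLpNorm (T n) 2 (densMeasure μ (P n)) ≤ C)
    (hT0 : ∀ n, eLpNorm (T n) 2 (densMeasure μ p₀) ≤ C)
    (hTm : MemLp T₀ 2 (densMeasure μ p₀))
    (hTT : ∀ᵐ x ∂(densMeasure μ p₀), Tendsto (fun n => T n x) atTop (𝓝 (T₀ x))) :
    Tendsto (fun n => (∫ x, T n x ∂(densMeasure μ (P n)) - ∫ x, T n x ∂(densMeasure μ p₀)) / t n)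
      atTop (𝓝 (∫ x, T₀ x * s x ∂(densMeasure μ p₀))) := by
  have m1 := h.meas; have m2 := h.meas₀; have m3 := h.score_meas
  have f0 := h.fin₀; have fn := h.fin
  refine tendsto_of_subseq_tendsto fun k hk => ?_
  have hm : TendstoInMeasure μ (fun n x => √(P (k n) x)) atTop (fun x => √(p₀ x)) :=
    tendstoInMeasure_of_tendsto_eLpNorm (p := 2) (by norm_num) (fun n => by fun_prop)
      (by fun_prop) (h.tendsto_hellinger.comp hk)
  obtain ⟨j, hj, hja⟩ := hm.exists_seq_tendsto_ae
  refine ⟨j, ?_⟩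
  have hkj := hk.comp hj.tendsto_atTop
  have h' := h.comp hkj
  set m := k ∘ j with hmdef
  have hac : densMeasure μ p₀ ≪ μ := withDensity_absolutelyContinuous _ _
  have hpos : ∀ᵐ x ∂(densMeasure μ p₀), 0 < p₀ x := by
    rw [densMeasure, ae_withDensity_iff (by fun_prop)]
    exact .of_forall fun x hx => by simpa using hx
  -- the principal term
  have hFle : ∀ n, eLpNorm (fun x => T (m n) x * (√(P (m n) x) / √(p₀ x) + 1) / 2) 2
      (densMeasure μ p₀) ≤ (C : ℝ≥0) := fun n => by
    rw [eLpNorm_two_densMeasure m2 h.nonneg₀]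
    have hb : eLpNorm (fun x => T (m n) x * √(P (m n) x) + T (m n) x * √(p₀ x)) 2 μ ≤
        C + C := by
      refine (eLpNorm_add_le (by fun_prop) (by fun_prop) (by norm_num)).trans ?_
      rw [← eLpNorm_two_densMeasure m2 h.nonneg₀, ← eLpNorm_two_densMeasure (m1 _) (h.nonneg _)]
      exact add_le_add (hTP _) (hT0 _)
    have hle : eLpNorm (fun x => T (m n) x * (√(P (m n) x) / √(p₀ x) + 1) / 2 * √(p₀ x)) 2 μ ≤
        ENNReal.ofReal (1 / 2) *
          eLpNorm (fun x => T (m n) x * √(P (m n) x) + T (m n) x * √(p₀ x)) 2 μ := by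
      refine eLpNorm_le_mul_eLpNorm_of_ae_le_mul (.of_forall fun x => ?_) 2
      rcases eq_or_ne (√(p₀ x)) 0 with h0 | h0
      · simp only [h0, mul_zero, norm_zero]; positivity
      · have e : T (m n) x * (√(P (m n) x) / √(p₀ x) + 1) / 2 * √(p₀ x) =
          1 / 2 * (T (m n) x * √(P (m n) x) + T (m n) x * √(p₀ x)) := by field_simp
        rw [e, norm_mul]; norm_num
    refine hle.trans ((mul_le_mul_right hb _).trans_eq ?_)
    rw [← ENNReal.coe_add, ← ENNReal.ofReal_coe_nnreal,
      ← ENNReal.ofReal_mul (by norm_num), ← ENNReal.ofReal_coe_nnreal]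
    congr 1; push_cast; ring
  have hA : Tendsto (fun n => ∫ x, T (m n) x * (√(P (m n) x) / √(p₀ x) + 1) / 2 * s x
      ∂(densMeasure μ p₀)) atTop (𝓝 (∫ x, T₀ x * s x ∂(densMeasure μ p₀))) := by
    refine tendsto_integral_mul_of_tendsto_ae
      (fun n => by have := hT (m n); have := m1 (m n); fun_prop) hFle hTm h.score_memLp ?_
    filter_upwards [hTT, hac hja, hpos] with x hx1 hx2 hx3
    have hs0 : √(p₀ x) ≠ 0 := (Real.sqrt_pos.2 hx3).ne'
    have := (((hx1.comp hkj).mul ((hx2.div_const (√(p₀ x))).add_const 1)).div_const 2)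
    convert! this using 2
    rw [div_self hs0]; ring
  -- the remainder
  have hB : Tendsto (fun n => ∫ x, (T (m n) x * √(P (m n) x) + T (m n) x * √(p₀ x)) *
      ((√(P (m n) x) - √(p₀ x)) / t (m n) - s x * √(p₀ x) / 2) ∂μ) atTop (𝓝 0) := by
    rw [tendsto_zero_iff_enorm_tendsto_zero]
    refine tendsto_of_tendsto_of_tendsto_of_le_of_le tendsto_const_nhds (h := fun n => (C + C) *
      eLpNorm (fun x => (√(P (m n) x) - √(p₀ x)) / t (m n) - s x * √(p₀ x) / 2) 2 μ) ?_
      (fun _ => zero_le) fun n => ?_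
    · simpa using ENNReal.Tendsto.const_mul h'.tendsto (a := (C + C : ℝ≥0∞)) (Or.inr (by simp))
    · have := hT (m n); have := m1 (m n)
      refine (enorm_integral_mul_le (by fun_prop) (by fun_prop)).trans ?_
      refine mul_le_mul_left ?_ _
      refine (eLpNorm_add_le (by fun_prop) (by fun_prop) (by norm_num)).trans ?_
      rw [← eLpNorm_two_densMeasure m2 h.nonneg₀, ← eLpNorm_two_densMeasure (m1 _) (h.nonneg _)]
      exact add_le_add (hTP _) (hT0 _)
  have hAB := hB.add hA
  rw [zero_add] at hAB
  refine hAB.congr fun n => ?_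
  have hTm := hT (m n); have hPm := m1 (m n)
  have hs := memLp_mul_sqrt m2 h.nonneg₀ m3 h.score_memLp.2
  have hL1 := memLp_mul_sqrt hPm (h.nonneg _) hTm ((hTP _).trans_lt (by simp))
  have hL2 := memLp_mul_sqrt m2 h.nonneg₀ hTm ((hT0 _).trans_lt (by simp))
  have one : ∀ r : X → ℝ, Measurable r → (∀ x, 0 ≤ r x) → IsFiniteMeasure (densMeasure μ r) →
      MemLp (fun x => √(r x)) 2 μ := fun r hr hr0 _ => by
    simpa using memLp_mul_sqrt hr hr0 (measurable_const (a := (1 : ℝ)))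
      ((memLp_const (μ := densMeasure μ r) (p := 2) (1 : ℝ)).2)
  have hd : MemLp (fun x => (√(P (m n) x) - √(p₀ x)) / t (m n)) 2 μ := by
    simpa [div_eq_mul_inv] using
      ((one _ hPm (h.nonneg _) (fn _)).sub (one _ m2 h.nonneg₀ f0)).mul_const (t (m n))⁻¹
  have hs2 : MemLp (fun x => s x * √(p₀ x) / 2) 2 μ := by
    simpa [div_eq_mul_inv] using hs.mul_const (2 : ℝ)⁻¹
  have i1 : Integrable (fun x => (T (m n) x * √(P (m n) x) + T (m n) x * √(p₀ x)) *
      ((√(P (m n) x) - √(p₀ x)) / t (m n) - s x * √(p₀ x) / 2)) μ :=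
    (hL1.add hL2).integrable_mul (hd.sub hs2)
  have i2 : Integrable (fun x => (T (m n) x * √(P (m n) x) + T (m n) x * √(p₀ x)) *
      (s x * √(p₀ x) / 2)) μ := (hL1.add hL2).integrable_mul hs2
  have e : ∫ x, T (m n) x * (√(P (m n) x) / √(p₀ x) + 1) / 2 * s x ∂(densMeasure μ p₀) =
      ∫ x, (T (m n) x * √(P (m n) x) + T (m n) x * √(p₀ x)) * (s x * √(p₀ x) / 2) ∂μ := by
    rw [integral_densMeasure m2 h.nonneg₀]
    refine integral_congr_ae (.of_forall fun x => ?_)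
    have h1 := Real.mul_self_sqrt (h.nonneg₀ x)
    rcases eq_or_ne (√(p₀ x)) 0 with h0 | h0
    · have h2 : p₀ x = 0 := by rw [← h1, h0, mul_zero]
      simp [h2]
    · simp only
      rw [← h1]; simp only [Real.sqrt_mul_self (Real.sqrt_nonneg _)]; field_simp
  have hI := integral_densMeasure_sub m2 h.nonneg₀ hPm (h.nonneg _) hTm
    ((hT0 _).trans_lt (by simp)) ((hTP _).trans_lt (by simp))
  change _ = (∫ x, T (m n) x ∂(densMeasure μ (P (m n))) - ∫ x, T (m n) x ∂(densMeasure μ p₀)) /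
    t (m n)
  rw [hI, e, ← integral_add i1 i2, ← integral_div]
  refine integral_congr_ae (.of_forall fun x => ?_)
  simp only; ring

/-- Sets on which `P n` carries at least four times the mass of the limit law have
`P n`-mass `o((t n)²)`. -/
theorem tendsto_sqrt_measure_div (h : QMDSeq μ P p₀ s t) {B : ℕ → Set X}
    (hB : ∀ n, MeasurableSet (B n))
    (hB4 : ∀ n, 4 * densMeasure μ p₀ (B n) ≤ densMeasure μ (P n) (B n)) :
    Tendsto (fun n => eLpNorm ((B n).indicator (fun _ => (1 : ℝ))) 2 (densMeasure μ (P n)))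
      atTop (𝓝 0) ∧
    Tendsto (fun n => eLpNorm ((B n).indicator (fun _ => (1 : ℝ))) 2 (densMeasure μ (P n)) /
      ‖t n‖ₑ) atTop (𝓝 0) := by
  have m1 := h.meas; have m2 := h.meas₀; have m3 := h.score_meas
  have f0 := h.fin₀; have fn := h.fin
  set N : ℕ → ℝ≥0∞ := fun n =>
    eLpNorm ((B n).indicator (fun _ => (1 : ℝ))) 2 (densMeasure μ (P n)) with hN
  have hN0 : ∀ n, eLpNorm ((B n).indicator (fun _ => (1 : ℝ))) 2 (densMeasure μ p₀) ≤
      N n / 2 := fun n => eLpNorm_indicator_one_le_half (hB n) (hB4 n)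
  have hNfin : ∀ n, N n ≠ ∞ := fun n =>
    ((memLp_const (μ := densMeasure μ (P n)) (p := 2) (1 : ℝ)).indicator (hB n)).2.ne
  have hNle : ∀ n, N n ≤
      2 * eLpNorm ((B n).indicator (fun x => √(P n x) - √(p₀ x))) 2 μ := fun n => by
    have hind : Measurable ((B n).indicator (fun _ : X => (1 : ℝ))) :=
      measurable_const.indicator (hB n)
    have hb : N n ≤ eLpNorm ((B n).indicator (fun x => √(P n x) - √(p₀ x))) 2 μ + N n / 2 := by
      refine le_trans ?_ (add_le_add_right (hN0 n) _)
      simp only [hN]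
      rw [eLpNorm_two_densMeasure (m1 n) (h.nonneg n), eLpNorm_two_densMeasure m2 h.nonneg₀]
      refine le_of_eq_of_le ?_ (eLpNorm_add_le
        (((by fun_prop : Measurable fun x => √(P n x) - √(p₀ x)).indicator
          (hB n)).aestronglyMeasurable) (by fun_prop) (by norm_num))
      congr 1
      ext x; by_cases hx : x ∈ B n <;> simp [hx]
    have hb2 : N n / 2 ≤ eLpNorm ((B n).indicator (fun x => √(P n x) - √(p₀ x))) 2 μ := by
      rw [← ENNReal.sub_half (hNfin n)]
      exact tsub_le_iff_right.2 hb
    calc N n = 2 * (N n / 2) := (ENNReal.mul_div_cancel (by simp) (by simp)).symm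
      _ ≤ _ := by gcongr
  have hN_tendsto : Tendsto N atTop (𝓝 0) := by
    refine tendsto_of_tendsto_of_tendsto_of_le_of_le tendsto_const_nhds (h := fun n =>
      2 * eLpNorm (fun x => √(P n x) - √(p₀ x)) 2 μ) ?_ (fun _ => zero_le)
      fun n => (hNle n).trans ?_
    · simpa using ENNReal.Tendsto.const_mul h.tendsto_hellinger (a := 2) (Or.inr (by simp))
    · exact mul_le_mul_right (eLpNorm_indicator_le _) _
  refine ⟨hN_tendsto, ?_⟩
  have hmeas : Tendsto (fun n => densMeasure μ p₀ (B n)) atTop (𝓝 0) := by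
    have h2 : Tendsto (fun n => N n ^ (2 : ℝ)) atTop (𝓝 0) := by
      simpa using hN_tendsto.ennrpow_const 2
    refine tendsto_of_tendsto_of_tendsto_of_le_of_le tendsto_const_nhds h2 (fun _ => zero_le)
      fun n => ?_
    simp only [hN]
    rw [eLpNorm_indicator_const (hB n) (by norm_num) (by norm_num)]
    simp only [enorm_one, one_mul]
    rw [← ENNReal.rpow_mul]
    norm_num
    exact le_trans (le_mul_of_one_le_left' (by norm_num)) (hB4 n)
  have hsB : Tendsto (fun n => eLpNorm ((B n).indicator s) 2 (densMeasure μ p₀)) atTop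
      (𝓝 0) := by
    rw [ENNReal.tendsto_nhds_zero]
    intro ε hε
    obtain ⟨ε', hε', hle⟩ : ∃ ε' : ℝ, 0 < ε' ∧ ENNReal.ofReal ε' ≤ ε := by
      rcases eq_or_ne ε ∞ with rfl | hne
      · exact ⟨1, one_pos, le_top⟩
      · exact ⟨ε.toReal, ENNReal.toReal_pos hε.ne' hne, ENNReal.ofReal_toReal_le⟩
    obtain ⟨δ, hδ, hδs⟩ := h.score_memLp.eLpNorm_indicator_le (by norm_num) (by norm_num) hε'
    filter_upwards [(ENNReal.tendsto_nhds_zero.1 hmeas) (ENNReal.ofReal δ) (by simpa)] with n hn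
    exact (hδs _ (hB n) hn).trans hle
  have hle : ∀ n, N n / ‖t n‖ₑ ≤
      2 * (eLpNorm (fun x => (√(P n x) - √(p₀ x)) / t n - s x * √(p₀ x) / 2) 2 μ +
        eLpNorm ((B n).indicator s) 2 (densMeasure μ p₀)) := fun n => by
    have ht0 : ‖t n‖ₑ ≠ 0 := by simpa using h.ne_zero n
    refine ENNReal.div_le_of_le_mul ((hNle n).trans ?_)
    rw [mul_assoc]
    gcongr
    have e : (B n).indicator (fun x => √(P n x) - √(p₀ x)) = t n • ((B n).indicator
        (fun x => (√(P n x) - √(p₀ x)) / t n - s x * √(p₀ x) / 2) +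
          fun x => (1 / 2 : ℝ) * ((B n).indicator s x * √(p₀ x))) := by
      have := h.ne_zero n
      ext x; by_cases hx : x ∈ B n <;> simp [hx]
      field_simp; ring
    rw [e, eLpNorm_const_smul, mul_comm]
    gcongr
    have hms : Measurable ((B n).indicator s) := m3.indicator (hB n)
    refine (eLpNorm_add_le (((by fun_prop : Measurable fun x =>
      (√(P n x) - √(p₀ x)) / t n - s x * √(p₀ x) / 2).indicator
          (hB n)).aestronglyMeasurable) (by fun_prop) (by norm_num)).trans ?_
    rw [eLpNorm_two_densMeasure m2 h.nonneg₀]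
    refine add_le_add (eLpNorm_indicator_le _) (eLpNorm_mono fun x => ?_)
    rw [norm_mul]
    refine mul_le_of_le_one_left (norm_nonneg _) (by norm_num)
  refine tendsto_of_tendsto_of_tendsto_of_le_of_le tendsto_const_nhds ?_ (fun _ => zero_le) hle
  simpa using ENNReal.Tendsto.const_mul (h.tendsto.add hsB) (a := 2) (Or.inr (by simp))

end QMDSeq
end Hellinger
end Semiparametric

namespace IV

section CondMean

set_option linter.unusedSectionVars false

variable {𝒵 : Type*} {𝒴 : Set ℝ} {𝓛 : Type*} [MeasurableSpace 𝒵] [MeasurableSpace 𝓛]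

@[fun_prop]
theorem Obs.measurable_Z : Measurable (Obs.Z : Obs 𝒵 𝒴 𝓛 → 𝒵) := by
  unfold Obs.Z; fun_prop

@[fun_prop]
theorem Obs.measurable_L : Measurable (Obs.L : Obs 𝒵 𝒴 𝓛 → 𝓛) := by
  unfold Obs.L; fun_prop

@[fun_prop]
theorem Obs.measurable_Y : Measurable (Obs.Y : Obs 𝒵 𝒴 𝓛 → ℝ) := by
  unfold Obs.Y; fun_prop

@[fun_prop]
theorem Obs.measurable_indA (a : Fin 2) : Measurable (Obs.indA a : Obs 𝒵 𝒴 𝓛 → ℝ) := by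
  have : (Obs.indA a : Obs 𝒵 𝒴 𝓛 → ℝ) = (fun b : Fin 2 => if b = a then (1 : ℝ) else 0) ∘
    fun o => o.2.1 := rfl
  rw [this]
  exact (measurable_of_finite _).comp (by fun_prop)

theorem Obs.indA_one : (Obs.indA 1 : Obs 𝒵 𝒴 𝓛 → ℝ) = Obs.A := by
  ext o
  unfold Obs.indA Obs.A
  generalize o.2.1 = b
  fin_cases b <;> simp

@[fun_prop]
theorem Obs.measurable_A : Measurable (Obs.A : Obs 𝒵 𝒴 𝓛 → ℝ) :=
  Obs.indA_one (𝒵 := 𝒵) (𝒴 := 𝒴) (𝓛 := 𝓛) ▸ Obs.measurable_indA 1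

theorem Obs.abs_indA_le (a : Fin 2) (o : Obs 𝒵 𝒴 𝓛) : |Obs.indA a o| ≤ 1 := by
  unfold Obs.indA; split_ifs <;> simp

theorem Obs.abs_A_le (o : Obs 𝒵 𝒴 𝓛) : |Obs.A o| ≤ 1 := by
  rw [← Obs.indA_one]; exact Obs.abs_indA_le 1 o

theorem measurable_wt {π : 𝒵 → 𝓛 → ℝ} (hπ : Measurable (Function.uncurry π)) :
    Measurable (wt π : Obs 𝒵 𝒴 𝓛 → ℝ) :=
  hπ.comp (Obs.measurable_Z.prodMk Obs.measurable_L)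

variable [StandardBorelSpace 𝒵] [Nonempty 𝒵] [StandardBorelSpace 𝒴] [Nonempty 𝒴]
  [StandardBorelSpace 𝓛] [Nonempty 𝓛] (Q : ProbabilityMeasure (Obs 𝒵 𝒴 𝓛))

instance isProbabilityMeasure_condLaw (l : 𝓛) : IsProbabilityMeasure (condLaw Q l) := by
  unfold condLaw; infer_instance

instance isProbabilityMeasure_lawL : IsProbabilityMeasure (lawL Q) :=
  Measure.isProbabilityMeasure_map (by fun_prop)

theorem lawL_compProd : lawL Q ⊗ₘ condDistrib (fun o : Obs 𝒵 𝒴 𝓛 => o) Obs.L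
    (Q : Measure (Obs 𝒵 𝒴 𝓛)) = (Q : Measure (Obs 𝒵 𝒴 𝓛)).map (fun o => (o.L, o)) :=
  compProd_map_condDistrib (by fun_prop)

theorem ae_of_ae_lawL {p : 𝓛 → Prop} (hp : ∀ᵐ l ∂(lawL Q), p l) :
    ∀ᵐ o ∂(Q : Measure (Obs 𝒵 𝒴 𝓛)), p o.L :=
  ae_of_ae_map (by fun_prop) hp

theorem integral_lawL {f : 𝓛 → ℝ} (hf : Measurable f) :
    ∫ l, f l ∂(lawL Q) = ∫ o, f o.L ∂(Q : Measure (Obs 𝒵 𝒴 𝓛)) :=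
  integral_map (by fun_prop) hf.aestronglyMeasurable

theorem measurable_integral_condLaw {h : 𝓛 × Obs 𝒵 𝒴 𝓛 → ℝ} (hh : Measurable h) :
    Measurable fun l => ∫ o, h (l, o) ∂(condLaw Q l) :=
  (hh.stronglyMeasurable.integral_kernel_prod_right' (κ := condDistrib
    (fun o : Obs 𝒵 𝒴 𝓛 => o) Obs.L (Q : Measure (Obs 𝒵 𝒴 𝓛)))).measurable

theorem lintegral_condLaw {h : 𝓛 × Obs 𝒵 𝒴 𝓛 → ℝ≥0∞} (hh : Measurable h) :
    ∫⁻ l, ∫⁻ o, h (l, o) ∂(condLaw Q l) ∂(lawL Q) =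
      ∫⁻ o, h (o.L, o) ∂(Q : Measure (Obs 𝒵 𝒴 𝓛)) := by
  have := Measure.lintegral_compProd (μ := lawL Q) (κ := condDistrib
    (fun o : Obs 𝒵 𝒴 𝓛 => o) Obs.L (Q : Measure (Obs 𝒵 𝒴 𝓛))) hh
  rw [lawL_compProd, lintegral_map hh (by fun_prop)] at this
  exact this.symm

/-- The tower property. -/
theorem integral_condLaw {h : 𝓛 × Obs 𝒵 𝒴 𝓛 → ℝ} (hh : Measurable h)
    (hi : Integrable (fun o => h (o.L, o)) (Q : Measure (Obs 𝒵 𝒴 𝓛))) :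
    ∫ l, ∫ o, h (l, o) ∂(condLaw Q l) ∂(lawL Q) =
      ∫ o, h (o.L, o) ∂(Q : Measure (Obs 𝒵 𝒴 𝓛)) := by
  have hi' : Integrable h ((Q : Measure (Obs 𝒵 𝒴 𝓛)).map (fun o => (o.L, o))) :=
    (integrable_map_measure hh.aestronglyMeasurable (by fun_prop)).2 hi
  rw [← lawL_compProd] at hi'
  have := Measure.integral_compProd hi'
  rw [lawL_compProd, integral_map (by fun_prop) hh.aestronglyMeasurable] at this
  exact this.symm

theorem integral_condLaw' {h : 𝓛 × Obs 𝒵 𝒴 𝓛 → ℝ} (hh : Measurable h)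
    (hi : Integrable (fun o => h (o.L, o)) (Q : Measure (Obs 𝒵 𝒴 𝓛))) :
    ∫ o', ∫ o, h (o'.L, o) ∂(condLaw Q o'.L) ∂(Q : Measure (Obs 𝒵 𝒴 𝓛)) =
      ∫ o, h (o.L, o) ∂(Q : Measure (Obs 𝒵 𝒴 𝓛)) := by
  rw [← integral_condLaw Q hh hi, integral_lawL Q (measurable_integral_condLaw Q hh)]

theorem measurable_condMean {f : Obs 𝒵 𝒴 𝓛 → ℝ} (hf : Measurable f) :
    Measurable (condMean Q f) :=
  measurable_integral_condLaw Q (h := fun x => f x.2) (by fun_prop)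

theorem measurable_condCov {f g : Obs 𝒵 𝒴 𝓛 → ℝ} (hf : Measurable f) (hg : Measurable g) :
    Measurable (condCov Q f g) := by
  have h1 := measurable_condMean Q hf
  have h2 := measurable_condMean Q hg
  exact measurable_integral_condLaw Q
    (h := fun x => (f x.2 - condMean Q f x.1) * (g x.2 - condMean Q g x.1)) (by fun_prop)

theorem abs_condMean_le {f : Obs 𝒵 𝒴 𝓛 → ℝ} {C : ℝ} (hf : ∀ o, |f o| ≤ C) (l : 𝓛) :
    |condMean Q f l| ≤ C := by
  have := norm_integral_le_of_norm_le_const (μ := condLaw Q l) (f := f) (C := C)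
    (.of_forall hf)
  simpa [condMean] using this

theorem memLp_of_abs_le {X : Type*} [MeasurableSpace X] {ν : Measure X} [IsFiniteMeasure ν]
    {f : X → ℝ} (hf : Measurable f) {C : ℝ} (hC : ∀ o, |f o| ≤ C) (r : ℝ≥0∞) : MemLp f r ν :=
  MemLp.of_bound hf.aestronglyMeasurable C (.of_forall hC)

theorem condCov_eq_sub {f g : Obs 𝒵 𝒴 𝓛 → ℝ} {l : 𝓛} (hf : MemLp f 2 (condLaw Q l))
    (hg : MemLp g 2 (condLaw Q l)) :
    condCov Q f g l = condMean Q (fun o => f o * g o) l - condMean Q f l * condMean Q g l :=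
  covariance_eq_sub hf hg

theorem ae_memLp_condLaw {f : Obs 𝒵 𝒴 𝓛 → ℝ} (hf : Measurable f)
    (h : MemLp f 2 (Q : Measure (Obs 𝒵 𝒴 𝓛))) : ∀ᵐ l ∂(lawL Q), MemLp f 2 (condLaw Q l) := by
  have h2 := h.2
  rw [eLpNorm_lt_top_iff_lintegral_rpow_enorm_lt_top (by norm_num) (by norm_num),
    ← lintegral_condLaw Q (h := fun x => ‖f x.2‖ₑ ^ (2 : ℝ≥0∞).toReal) (by fun_prop)] at h2
  have hm : Measurable fun l => ∫⁻ o, ‖f o‖ₑ ^ (2 : ℝ≥0∞).toReal ∂(condLaw Q l) :=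
    Measurable.lintegral_kernel (κ := condDistrib (fun o : Obs 𝒵 𝒴 𝓛 => o) Obs.L
      (Q : Measure (Obs 𝒵 𝒴 𝓛))) (by fun_prop)
  filter_upwards [ae_lt_top hm h2.ne] with l hl
  exact ⟨hf.aestronglyMeasurable,
    (eLpNorm_lt_top_iff_lintegral_rpow_enorm_lt_top (by norm_num) (by norm_num)).2 hl⟩

/-- Conditional expectation contracts the `L²` norm. -/
theorem eLpNorm_condMean_le {f : Obs 𝒵 𝒴 𝓛 → ℝ} (hf : Measurable f) :
    eLpNorm (fun o => condMean Q f o.L) 2 (Q : Measure (Obs 𝒵 𝒴 𝓛)) ≤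
      eLpNorm f 2 (Q : Measure (Obs 𝒵 𝒴 𝓛)) := by
  have h1 := measurable_condMean Q hf
  rw [eLpNorm_eq_lintegral_rpow_enorm_toReal (by norm_num) (by norm_num),
    eLpNorm_eq_lintegral_rpow_enorm_toReal (by norm_num) (by norm_num),
    ← lintegral_condLaw Q (h := fun x => ‖f x.2‖ₑ ^ (2 : ℝ≥0∞).toReal) (by fun_prop),
    ← lintegral_map (μ := (Q : Measure (Obs 𝒵 𝒴 𝓛))) (g := Obs.L)
      (f := fun l => ‖condMean Q f l‖ₑ ^ (2 : ℝ≥0∞).toReal) (by fun_prop) (by fun_prop)]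
  refine ENNReal.rpow_le_rpow (lintegral_mono fun l => ?_) (by norm_num)
  have h2 : ‖condMean Q f l‖ₑ ≤ eLpNorm f 2 (condLaw Q l) := by
    refine (enorm_integral_le_lintegral_enorm _).trans ?_
    rw [← eLpNorm_one_eq_lintegral_enorm]
    exact eLpNorm_le_eLpNorm_of_exponent_le (by norm_num) hf.aestronglyMeasurable
  refine (ENNReal.rpow_le_rpow h2 (by norm_num)).trans_eq ?_
  rw [eLpNorm_eq_lintegral_rpow_enorm_toReal (by norm_num) (by norm_num), ← ENNReal.rpow_mul]
  norm_num

/-- Comparison of conditional means under two laws: the test function `g(L)(E_Q[f | L] - f)` has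
mean zero under `Q`. -/
theorem integral_mul_condMean_sub {f : Obs 𝒵 𝒴 𝓛 → ℝ} (hf : Measurable f) {C : ℝ}
    (hC : ∀ o, |f o| ≤ C) {g k : 𝓛 → ℝ} (hg : Measurable g) {D : ℝ} (hD : ∀ l, |g l| ≤ D)
    (hk : Measurable k) (hkC : ∀ l, |k l| ≤ C) :
    ∫ o, g o.L * (k o.L - condMean Q f o.L) ∂(Q : Measure (Obs 𝒵 𝒴 𝓛)) =
      ∫ o, g o.L * (k o.L - f o) ∂(Q : Measure (Obs 𝒵 𝒴 𝓛)) := by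
  have hi : Integrable (fun o => g (Obs.L o) * (k o.L - f o)) (Q : Measure (Obs 𝒵 𝒴 𝓛)) := by
    refine Integrable.of_bound (by fun_prop) (D * (C + C)) (.of_forall fun o => ?_)
    rw [norm_mul]
    exact mul_le_mul (hD _) ((norm_sub_le _ _).trans (add_le_add (hkC _) (hC _)))
      (norm_nonneg _) ((abs_nonneg _).trans (hD o.L))
  rw [← integral_condLaw' Q (h := fun x => g x.1 * (k x.1 - f x.2)) (by fun_prop) hi]
  refine integral_congr_ae (.of_forall fun o => ?_)
  have : Integrable f (condLaw Q o.L) :=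
    memLp_one_iff_integrable.1 (memLp_of_abs_le hf hC 1)
  simp only
  rw [integral_const_mul, integral_sub (integrable_const _) this]
  simp [condMean]

end CondMean
end IV

namespace IV

theorem integral_sub_mul_residual {X : Type*} [MeasurableSpace X] {ν : Measure X}
    [IsProbabilityMeasure ν] {Y A w : X → ℝ} (hY : MemLp Y 2 ν) (hA : MemLp A 2 ν)
    (hw : MemLp w 2 ν) (r g c : ℝ) :
    ∫ x, (w x - r) * (Y x - g * A x - c) ∂ν =
      covariance Y w ν - g * covariance A w ν +
        (∫ x, w x ∂ν - r) * (∫ x, Y x ∂ν - g * ∫ x, A x ∂ν - c) := by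
  have e : ∀ x, (w x - r) * (Y x - g * A x - c) =
      Y x * w x - g * (A x * w x) - c * w x - r * Y x + r * g * A x + r * c := fun x => by ring
  have i1 : Integrable (fun x => Y x * w x) ν := hY.integrable_mul hw
  have i2 : Integrable (fun x => A x * w x) ν := hA.integrable_mul hw
  have i3 := hY.integrable (by norm_num)
  have i4 := hA.integrable (by norm_num)
  have i5 := hw.integrable (by norm_num)
  rw [covariance_eq_sub hY hw, covariance_eq_sub hA hw]
  simp_rw [e]
  rw [integral_add (by fun_prop) (by fun_prop), integral_add (by fun_prop) (by fun_prop),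
    integral_sub (by fun_prop) (by fun_prop), integral_sub (by fun_prop) (by fun_prop),
    integral_sub (by fun_prop) (by fun_prop)]
  simp only [integral_const_mul, integral_const, probReal_univ, one_smul, Pi.mul_apply]
  ring

/-- The inverse, truncated to `0` near `0`. -/
def clipInv (e x : ℝ) : ℝ := if e ≤ |x| then x⁻¹ else 0

theorem abs_clipInv_le {e : ℝ} (he : 0 < e) (x : ℝ) : |clipInv e x| ≤ e⁻¹ := by
  unfold clipInv
  split_ifs with h
  · rw [abs_inv]; exact inv_anti₀ he h
  · simpa using he.le

@[fun_prop]
theorem measurable_clipInv (e : ℝ) : Measurable (clipInv e) :=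
  Measurable.ite (measurableSet_le measurable_const measurable_id.abs) measurable_inv
    measurable_const

theorem tendsto_clipInv {e x : ℝ} (he : 0 < e) (hx : e < |x|) :
    Tendsto (clipInv e) (𝓝 x) (𝓝 x⁻¹) := by
  have hx0 : x ≠ 0 := by rintro rfl; simp at hx; linarith
  refine (tendsto_inv₀ hx0).congr' ?_
  filter_upwards [(continuous_abs.tendsto x).eventually_const_lt hx] with y hy
  simp [clipInv, hy.le]

section Functional

set_option linter.unusedSectionVars false

variable {𝒵 : Type*} {𝒴 : Set ℝ} {𝓛 : Type*} [MeasurableSpace 𝒵] [MeasurableSpace 𝓛]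
  [StandardBorelSpace 𝒵] [Nonempty 𝒵] [StandardBorelSpace 𝒴] [Nonempty 𝒴]
  [StandardBorelSpace 𝓛] [Nonempty 𝓛] (Q : ProbabilityMeasure (Obs 𝒵 𝒴 𝓛))
  {π : 𝒵 → 𝓛 → ℝ}

theorem RelevanceBound.ae_le {ε : ℝ} {Q : ProbabilityMeasure (Obs 𝒵 𝒴 𝓛)}
    (h : RelevanceBound π ε Q) :
    ∀ᵐ l ∂(lawL Q), ε ≤ |condCov Q Obs.A (wt π) l| := by
  have := h 1; rwa [Obs.indA_one] at this

theorem abs_condCov_le {C : ℝ} (hπm : Measurable (Function.uncurry π))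
    (hC : ∀ z l, |π z l| ≤ C) {l : 𝓛} (hY : MemLp Obs.Y 2 (condLaw Q l)) :
    |condCov Q Obs.Y (wt π) l| ≤ 2 * C * condMean Q (fun o => |o.Y|) l := by
  have hw := measurable_wt (𝒴 := 𝒴) hπm
  have hwC : ∀ o : Obs 𝒵 𝒴 𝓛, |wt π o| ≤ C := fun o => hC _ _
  have iY := (hY.integrable (by norm_num)).abs
  rw [condCov_eq_sub Q hY (memLp_of_abs_le hw hwC 2)]
  have h1 : |condMean Q (fun o => o.Y * wt π o) l| ≤ C * condMean Q (fun o => |o.Y|) l := by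
    unfold condMean
    rw [← integral_const_mul, ← Real.norm_eq_abs]
    refine norm_integral_le_of_norm_le (iY.const_mul C) (.of_forall fun o => ?_)
    rw [Real.norm_eq_abs, abs_mul, mul_comm]
    exact mul_le_mul_of_nonneg_right (hwC o) (abs_nonneg _)
  have h2 : |condMean Q Obs.Y l| ≤ condMean Q (fun o => |o.Y|) l := abs_integral_le_integral_abs
  have h3 := abs_condMean_le Q hwC l
  have h4 : 0 ≤ condMean Q (fun o => |o.Y|) l := (abs_nonneg _).trans h2
  calc _ ≤ |condMean Q (fun o => o.Y * wt π o) l| +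
        |condMean Q Obs.Y l| * |condMean Q (wt π) l| := by
        rw [← abs_mul]; exact abs_sub _ _
    _ ≤ C * condMean Q (fun o => |o.Y|) l + condMean Q (fun o => |o.Y|) l * C := by gcongr
    _ = _ := by ring

theorem measurable_trueNuisance_γ (hπm : Measurable (Function.uncurry π)) :
    Measurable (trueNuisance π Q).γ :=
  (measurable_condCov Q (by fun_prop) (measurable_wt hπm)).div
    (measurable_condCov Q (by fun_prop) (measurable_wt hπm))

theorem measurable_trueNuisance_κ (hπm : Measurable (Function.uncurry π)) :
    Measurable (trueNuisance π Q).κ :=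
  measurable_condCov Q (by fun_prop) (measurable_wt hπm)

theorem measurable_trueNuisance_ρ (hπm : Measurable (Function.uncurry π)) :
    Measurable (trueNuisance π Q).ρ :=
  measurable_condMean Q (measurable_wt hπm)

theorem measurable_trueNuisance_δ : Measurable (trueNuisance π Q).δ :=
  measurable_condMean Q (by fun_prop)

theorem measurable_trueNuisance_η : Measurable (trueNuisance π Q).η :=
  measurable_condMean Q (by fun_prop)

theorem abs_trueNuisance_δ_le (l : 𝓛) : |(trueNuisance π Q).δ l| ≤ 1 :=
  abs_condMean_le Q Obs.abs_A_le l

theorem abs_trueNuisance_ρ_le {C : ℝ} (hC : ∀ z l, |π z l| ≤ C) (l : 𝓛) :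
    |(trueNuisance π Q).ρ l| ≤ C :=
  abs_condMean_le Q (fun _ => hC _ _) l

theorem eLpNorm_γ_le {C ε : ℝ} (hε : 0 < ε) (hπm : Measurable (Function.uncurry π))
    (hC : ∀ z l, |π z l| ≤ C) (hY : MemLp Obs.Y 2 (Q : Measure (Obs 𝒵 𝒴 𝓛)))
    (hQ : RelevanceBound π ε Q) :
    eLpNorm (fun o => (trueNuisance π Q).γ o.L) 2 (Q : Measure (Obs 𝒵 𝒴 𝓛)) ≤
      ENNReal.ofReal (2 * C / ε) * eLpNorm Obs.Y 2 (Q : Measure (Obs 𝒵 𝒴 𝓛)) := by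
  have hle : ∀ᵐ o ∂(Q : Measure (Obs 𝒵 𝒴 𝓛)), ‖(trueNuisance π Q).γ o.L‖ ≤
      2 * C / ε * ‖condMean Q (fun o => |o.Y|) o.L‖ := by
    filter_upwards [ae_of_ae_lawL Q hQ.ae_le,
      ae_of_ae_lawL Q (ae_memLp_condLaw Q (by fun_prop) hY)] with o h1 h2
    have h3 := abs_condCov_le Q hπm hC h2
    have h0 : 0 ≤ condMean Q (fun o => |o.Y|) o.L := integral_nonneg fun _ => abs_nonneg _
    have hC0 : 0 ≤ C := (abs_nonneg _).trans (hC o.Z o.L)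
    rw [Real.norm_of_nonneg h0]
    change |condCov Q Obs.Y (wt π) o.L / condCov Q Obs.A (wt π) o.L| ≤ _
    rw [abs_div, div_le_iff₀ (hε.trans_le h1)]
    refine h3.trans ?_
    have e : 2 * C * condMean Q (fun o => |o.Y|) o.L =
        2 * C / ε * condMean Q (fun o => |o.Y|) o.L * ε := by field_simp
    rw [e]
    gcongr
  have e : eLpNorm (fun o => |Obs.Y o|) 2 (Q : Measure (Obs 𝒵 𝒴 𝓛)) =
      eLpNorm Obs.Y 2 (Q : Measure (Obs 𝒵 𝒴 𝓛)) := eLpNorm_norm Obs.Y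
  have h := eLpNorm_condMean_le Q (f := fun o => |o.Y|) (by fun_prop)
  rw [e] at h
  exact (eLpNorm_le_mul_eLpNorm_of_ae_le_mul hle 2).trans (mul_le_mul_right h _)

theorem memLp_γ {C ε : ℝ} (hε : 0 < ε) (hπm : Measurable (Function.uncurry π))
    (hC : ∀ z l, |π z l| ≤ C) (hY : MemLp Obs.Y 2 (Q : Measure (Obs 𝒵 𝒴 𝓛)))
    (hQ : RelevanceBound π ε Q) :
    MemLp (fun o => (trueNuisance π Q).γ o.L) 2 (Q : Measure (Obs 𝒵 𝒴 𝓛)) :=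
  ⟨((measurable_trueNuisance_γ Q hπm).comp Obs.measurable_L).aestronglyMeasurable,
    (eLpNorm_γ_le Q hε hπm hC hY hQ).trans_lt (ENNReal.mul_lt_top (by simp) hY.2)⟩

theorem memLp_η (hY : MemLp Obs.Y 2 (Q : Measure (Obs 𝒵 𝒴 𝓛))) :
    MemLp (fun o => (trueNuisance π Q).η o.L) 2 (Q : Measure (Obs 𝒵 𝒴 𝓛)) :=
  ⟨((measurable_trueNuisance_η Q).comp Obs.measurable_L).aestronglyMeasurable,
    (eLpNorm_condMean_le Q (by fun_prop)).trans_lt hY.2⟩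

/-- The residual `Y - E_P[Y | L] - γ(L)(A - E_P[A | L])`. -/
def residual (α : Nuisance 𝓛) (o : Obs 𝒵 𝒴 𝓛) : ℝ :=
  o.Y - α.γ o.L * o.A - (α.η o.L - α.γ o.L * α.δ o.L)

/-- `|γ| + |η|`, which together with `|Y|` dominates the residual. -/
def envelope (α : Nuisance 𝓛) (l : 𝓛) : ℝ := |α.γ l| + |α.η l|

theorem phi_eq (ψ : ℝ) (α : Nuisance 𝓛) (o : Obs 𝒵 𝒴 𝓛) :
    phi π ψ α o = α.γ o.L + (α.κ o.L)⁻¹ * ((wt π o - α.ρ o.L) * residual α o) - ψ := by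
  unfold phi residual wt; ring

theorem measurable_residual (hπm : Measurable (Function.uncurry π)) :
    Measurable (residual (trueNuisance π Q) : Obs 𝒵 𝒴 𝓛 → ℝ) := by
  have h1 := measurable_trueNuisance_γ Q hπm
  have h2 := measurable_trueNuisance_δ Q (π := π)
  have h3 := measurable_trueNuisance_η Q (π := π)
  generalize trueNuisance π Q = α at *
  unfold residual; fun_prop

theorem measurable_envelope (hπm : Measurable (Function.uncurry π)) :
    Measurable (envelope (trueNuisance π Q)) := by
  have h1 := measurable_trueNuisance_γ Q hπm
  have h3 := measurable_trueNuisance_η Q (π := π)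
  generalize trueNuisance π Q = α at *
  unfold envelope; fun_prop

theorem abs_residual_le (o : Obs 𝒵 𝒴 𝓛) :
    |residual (trueNuisance π Q) o| ≤ |o.Y| + 2 * envelope (trueNuisance π Q) o.L := by
  unfold residual envelope
  have h1 := Obs.abs_A_le o
  have h2 := abs_trueNuisance_δ_le (π := π) Q o.L
  set α := trueNuisance π Q
  have h3 : |α.γ o.L * o.A| ≤ |α.γ o.L| := by
    rw [abs_mul]; exact mul_le_of_le_one_right (abs_nonneg _) h1
  have h4 : |α.γ o.L * α.δ o.L| ≤ |α.γ o.L| := by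
    rw [abs_mul]; exact mul_le_of_le_one_right (abs_nonneg _) h2
  have h5 := abs_sub (Obs.Y o - α.γ o.L * o.A) (α.η o.L - α.γ o.L * α.δ o.L)
  have h6 := abs_sub (Obs.Y o) (α.γ o.L * o.A)
  have h7 := abs_sub (α.η o.L) (α.γ o.L * α.δ o.L)
  have := abs_nonneg (α.η o.L)
  linarith

theorem memLp_envelope {C ε : ℝ} (hε : 0 < ε) (hπm : Measurable (Function.uncurry π))
    (hC : ∀ z l, |π z l| ≤ C) (hY : MemLp Obs.Y 2 (Q : Measure (Obs 𝒵 𝒴 𝓛)))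
    (hQ : RelevanceBound π ε Q) :
    MemLp (fun o => envelope (trueNuisance π Q) o.L) 2 (Q : Measure (Obs 𝒵 𝒴 𝓛)) :=
  (memLp_γ Q hε hπm hC hY hQ).abs.add (memLp_η Q hY).abs

/-- Conditioning on `L` in the mean of a weighted product of residuals. -/
theorem integral_mul_residual (hπm : Measurable (Function.uncurry π)) {C : ℝ}
    (hC : ∀ z l, |π z l| ≤ C) (hY : MemLp Obs.Y 2 (Q : Measure (Obs 𝒵 𝒴 𝓛)))
    {k r : 𝓛 → ℝ} (hk : Measurable k) (hr : Measurable r)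
    {α : Nuisance 𝓛} (hγ : Measurable α.γ) (hη : Measurable α.η) (hδ : Measurable α.δ)
    (hi : Integrable (fun o => k o.L * ((wt π o - r o.L) * residual α o))
      (Q : Measure (Obs 𝒵 𝒴 𝓛))) :
    ∫ o, k o.L * ((wt π o - r o.L) * residual α o) ∂(Q : Measure (Obs 𝒵 𝒴 𝓛)) =
      ∫ o : Obs 𝒵 𝒴 𝓛, k o.L * (condCov Q Obs.Y (wt π) o.L -
        α.γ o.L * condCov Q Obs.A (wt π) o.L + (condMean Q (wt π) o.L - r o.L) *
          (condMean Q Obs.Y o.L - α.γ o.L * condMean Q Obs.A o.L -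
            (α.η o.L - α.γ o.L * α.δ o.L))) ∂(Q : Measure (Obs 𝒵 𝒴 𝓛)) := by
  have hw := measurable_wt (𝒴 := 𝒴) hπm
  have hwC : ∀ o : Obs 𝒵 𝒴 𝓛, |wt π o| ≤ C := fun o => hC _ _
  refine (integral_condLaw' Q (h := fun x : 𝓛 × Obs 𝒵 𝒴 𝓛 => k x.1 * ((wt π x.2 - r x.1) *
    (x.2.Y - α.γ x.1 * x.2.A - (α.η x.1 - α.γ x.1 * α.δ x.1)))) (by fun_prop) hi).symm.trans ?_
  refine integral_congr_ae ?_
  filter_upwards [ae_of_ae_lawL Q (ae_memLp_condLaw Q (by fun_prop) hY)] with o ho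
  rw [integral_const_mul, integral_sub_mul_residual ho
    (memLp_of_abs_le (by fun_prop) Obs.abs_A_le 2) (memLp_of_abs_le hw hwC 2)]
  rfl

theorem memLp_mul_residual (hπm : Measurable (Function.uncurry π)) {C : ℝ}
    (hC : ∀ z l, |π z l| ≤ C) {ν : Measure (Obs 𝒵 𝒴 𝓛)}
    {k r : 𝓛 → ℝ} (hk : Measurable k) (hr : Measurable r) (hrC : ∀ l, |r l| ≤ C)
    {D : ℝ} (hD : ∀ᵐ o ∂ν, |k o.L| ≤ D)
    {α : Nuisance 𝓛} (hα : MemLp (residual α) 2 ν) :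
    MemLp (fun o => k o.L * ((wt π o - r o.L) * residual α o)) 2 ν := by
  have hw := measurable_wt (𝒴 := 𝒴) hπm
  refine (hα.norm.const_mul (D * (2 * C))).mono
    ((hk.comp Obs.measurable_L).aestronglyMeasurable.mul
      ((hw.sub (hr.comp Obs.measurable_L)).aestronglyMeasurable.mul hα.1)) ?_
  filter_upwards [hD] with o ho
  have hC0 : 0 ≤ C := (abs_nonneg _).trans (hrC o.L)
  have hD0 : 0 ≤ D := (abs_nonneg _).trans ho
  have h1 : |wt π o - r o.L| ≤ 2 * C := by
    have := abs_sub (wt π o) (r o.L); have := hrC o.L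
    have : |wt π o| ≤ C := hC _ _
    linarith
  simp only [norm_mul, Real.norm_eq_abs, abs_abs]
  rw [abs_of_nonneg hD0, abs_of_nonneg hC0, abs_two, ← mul_assoc]
  gcongr

section InfluenceFunction

variable (P : ProbabilityMeasure (Obs 𝒵 𝒴 𝓛))
  {ε C : ℝ} (hε : 0 < ε) (hπm : Measurable (Function.uncurry π))
  (hC : ∀ z l, |π z l| ≤ C) (hY : MemLp Obs.Y 2 (P : Measure (Obs 𝒵 𝒴 𝓛)))
  (hP : RelevanceBound π ε P)

include hε hπm hC hY hP

theorem memLp_residual : MemLp (residual (trueNuisance π P)) 2 (P : Measure (Obs 𝒵 𝒴 𝓛)) :=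
  (hY.abs.add ((memLp_envelope P hε hπm hC hY hP).const_mul 2)).mono
    (measurable_residual P hπm).aestronglyMeasurable
    (.of_forall fun o => (abs_residual_le P o).trans (le_abs_self _))

theorem ae_abs_inv_κ_le : ∀ᵐ o ∂(P : Measure (Obs 𝒵 𝒴 𝓛)),
    |((trueNuisance π P).κ o.L)⁻¹| ≤ ε⁻¹ := by
  filter_upwards [ae_of_ae_lawL P hP.ae_le] with o ho
  rw [abs_inv]; exact inv_anti₀ hε ho

/-- The centred product of residuals has conditional mean zero given `L`. -/
theorem integral_mul_residual_eq_zero {k r : 𝓛 → ℝ} (hk : Measurable k) (hr : Measurable r)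
    (hrC : ∀ l, |r l| ≤ C) {D : ℝ} (hD : ∀ᵐ o ∂(P : Measure (Obs 𝒵 𝒴 𝓛)), |k o.L| ≤ D) :
    ∫ o, k o.L * ((wt π o - r o.L) * residual (trueNuisance π P) o)
      ∂(P : Measure (Obs 𝒵 𝒴 𝓛)) = 0 := by
  rw [integral_mul_residual P hπm hC hY hk hr (measurable_trueNuisance_γ P hπm)
    (measurable_trueNuisance_η P) (measurable_trueNuisance_δ P)
    ((memLp_mul_residual hπm hC hk hr hrC hD
      (memLp_residual P hε hπm hC hY hP)).integrable (by norm_num))]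
  refine integral_eq_zero_of_ae ?_
  filter_upwards [ae_of_ae_lawL P hP.ae_le] with o ho
  have h0 : condCov P Obs.A (wt π) o.L ≠ 0 := by
    intro h; rw [h, abs_zero] at ho; linarith
  have e : (trueNuisance π P).γ o.L * condCov P Obs.A (wt π) o.L =
      condCov P Obs.Y (wt π) o.L := div_mul_cancel₀ _ h0
  rw [e]
  simp [trueNuisance]

theorem memLp_phi (ψ : ℝ) :
    MemLp (phi π ψ (trueNuisance π P)) 2 (P : Measure (Obs 𝒵 𝒴 𝓛)) := by
  have h := ((memLp_γ P hε hπm hC hY hP).add (memLp_mul_residual hπm hC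
    (measurable_trueNuisance_κ P hπm).inv (measurable_trueNuisance_ρ P hπm)
    (abs_trueNuisance_ρ_le P hC) (ae_abs_inv_κ_le P hε hπm hC hY hP)
    (memLp_residual P hε hπm hC hY hP))).sub (memLp_const ψ)
  exact (memLp_congr_ae (.of_forall fun o => (phi_eq ψ _ o).symm)).1 h

theorem integral_phi :
    ∫ o, phi π (psi π P) (trueNuisance π P) o ∂(P : Measure (Obs 𝒵 𝒴 𝓛)) = 0 := by
  have h1 := (memLp_γ P hε hπm hC hY hP).integrable (by norm_num)
  have h2 := (memLp_mul_residual hπm hC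
    (measurable_trueNuisance_κ P hπm).inv (measurable_trueNuisance_ρ P hπm)
    (abs_trueNuisance_ρ_le P hC) (ae_abs_inv_κ_le P hε hπm hC hY hP)
    (memLp_residual P hε hπm hC hY hP)).integrable (by norm_num)
  have h3 := integral_mul_residual_eq_zero P hε hπm hC hY hP
    (measurable_trueNuisance_κ P hπm).inv (measurable_trueNuisance_ρ P hπm)
    (abs_trueNuisance_ρ_le P hC) (ae_abs_inv_κ_le P hε hπm hC hY hP)
  have h4 : ∫ o, ((trueNuisance π P).γ (Obs.L o) + ((trueNuisance π P).κ o.L)⁻¹ *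
      ((wt π o - (trueNuisance π P).ρ o.L) * residual (trueNuisance π P) o))
        ∂(P : Measure (Obs 𝒵 𝒴 𝓛)) = psi π P := by
    refine (integral_add h1 h2).trans ?_
    exact (congrArg _ h3).trans (add_zero _)
  simp_rw [phi_eq]
  refine (integral_sub (h1.add h2) (integrable_const _)).trans ?_
  refine (congrArg (· - _) h4).trans ?_
  simp

end InfluenceFunction
end Functional
end IV

theorem MeasureTheory.exists_seq_forall_tendsto_ae {X ι : Type*} [MeasurableSpace X] [Fintype ι]
    {ν : Measure X} {f : ι → ℕ → X → ℝ} (hf : ∀ i n, AEStronglyMeasurable (f i n) ν)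
    (h : ∀ i, Tendsto (fun n => eLpNorm (f i n) 1 ν) atTop (𝓝 0)) :
    ∃ k : ℕ → ℕ, StrictMono k ∧
      ∀ᵐ x ∂ν, ∀ i, Tendsto (fun n => f i (k n) x) atTop (𝓝 0) := by
  have h0 : Tendsto (fun n => eLpNorm ((∑ i, fun x => ‖f i n x‖) - fun _ => (0 : ℝ)) 1 ν)
      atTop (𝓝 0) := by
    refine tendsto_of_tendsto_of_tendsto_of_le_of_le tendsto_const_nhds (h := fun n =>
      ∑ i, eLpNorm (f i n) 1 ν) ?_ (fun _ => zero_le) fun n => ?_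
    · simpa using tendsto_finsetSum Finset.univ fun i _ => h i
    · have e : ((∑ i, fun x => ‖f i n x‖) - fun _ => (0 : ℝ)) = ∑ i, fun x => ‖f i n x‖ :=
        sub_zero _
      simp only [e]
      refine (eLpNorm_sum_le (fun i _ => (hf i n).norm) le_rfl).trans_eq ?_
      simp_rw [eLpNorm_norm]
  obtain ⟨k, hk, hka⟩ := (tendstoInMeasure_of_tendsto_eLpNorm one_ne_zero
    (fun n => Finset.aestronglyMeasurable_sum _ fun i _ => (hf i n).norm)
    aestronglyMeasurable_const h0).exists_seq_tendsto_ae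
  refine ⟨k, hk, ?_⟩
  filter_upwards [hka] with x hx i
  refine squeeze_zero_norm (fun n => ?_) hx
  rw [Finset.sum_apply]
  exact Finset.single_le_sum (f := fun i => ‖f i (k n) x‖) (fun _ _ => norm_nonneg _)
    (Finset.mem_univ i)

namespace IV

section Pair

set_option linter.unusedSectionVars false

variable {𝒵 : Type*} {𝒴 : Set ℝ} {𝓛 : Type*} [MeasurableSpace 𝒵] [MeasurableSpace 𝓛]
  [StandardBorelSpace 𝒵] [Nonempty 𝒵] [StandardBorelSpace 𝒴] [Nonempty 𝒴]
  [StandardBorelSpace 𝓛] [Nonempty 𝓛] {π : 𝒵 → 𝓛 → ℝ}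

open Semiparametric in
theorem eLpNorm_condMean_sub_le {μ : Measure (Obs 𝒵 𝒴 𝓛)} {p q : Obs 𝒵 𝒴 𝓛 → ℝ}
    (hp : Measurable p) (hp0 : ∀ x, 0 ≤ p x) (hq : Measurable q) (hq0 : ∀ x, 0 ≤ q x)
    {P Q : ProbabilityMeasure (Obs 𝒵 𝒴 𝓛)} (hP : (P : Measure (Obs 𝒵 𝒴 𝓛)) = densMeasure μ p)
    (hQ : (Q : Measure (Obs 𝒵 𝒴 𝓛)) = densMeasure μ q)
    {f : Obs 𝒵 𝒴 𝓛 → ℝ} (hf : Measurable f) {C : ℝ} (hC : ∀ o, |f o| ≤ C) :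
    eLpNorm (fun o => condMean Q f o.L - condMean P f o.L) 1 (P : Measure (Obs 𝒵 𝒴 𝓛)) ≤
      (ENNReal.ofReal (2 * C) + ENNReal.ofReal (2 * C)) *
        eLpNorm (fun x => √(q x) - √(p x)) 2 μ := by
  have mP := measurable_condMean P hf
  have mQ := measurable_condMean Q hf
  set g : 𝓛 → ℝ := fun l => if 0 ≤ condMean Q f l - condMean P f l then 1 else -1 with hg
  have mg : Measurable g :=
    Measurable.ite (measurableSet_le measurable_const (mQ.sub mP)) measurable_const
      measurable_const
  have hg1 : ∀ l, |g l| ≤ 1 := fun l => by simp only [hg]; split_ifs <;> simp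
  have hQC : ∀ l, |condMean Q f l| ≤ C := abs_condMean_le Q hC
  have e1 := integral_mul_condMean_sub P hf hC mg hg1 mQ hQC
  have e2 := integral_mul_condMean_sub Q hf hC mg hg1 mQ hQC
  simp only [sub_self, mul_zero, integral_zero] at e2
  set h : Obs 𝒵 𝒴 𝓛 → ℝ := fun o => g o.L * (condMean Q f o.L - f o) with hh
  have mh : Measurable h := by fun_prop
  have hb : ∀ o, ‖h o‖ ≤ 2 * C := fun o => by
    rw [hh]; simp only
    rw [norm_mul]
    calc _ ≤ 1 * (C + C) := mul_le_mul (hg1 _)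
          ((norm_sub_le _ _).trans (add_le_add (hQC _) (hC _))) (norm_nonneg _) zero_le_one
      _ = _ := by ring
  have hle : ∀ R : ProbabilityMeasure (Obs 𝒵 𝒴 𝓛),
      eLpNorm h 2 (R : Measure (Obs 𝒵 𝒴 𝓛)) ≤ ENNReal.ofReal (2 * C) := fun R => by
    refine (eLpNorm_le_of_ae_bound (.of_forall hb)).trans_eq ?_
    simp
  have hi : Integrable (fun o : Obs 𝒵 𝒴 𝓛 => condMean Q f o.L - condMean P f o.L)
      (P : Measure (Obs 𝒵 𝒴 𝓛)) := by
    refine Integrable.of_bound (by fun_prop) (C + C) (.of_forall fun o => ?_)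
    exact (norm_sub_le _ _).trans (add_le_add (hQC _) (abs_condMean_le P hC _))
  have e3 : eLpNorm (fun o => condMean Q f o.L - condMean P f o.L) 1
      (P : Measure (Obs 𝒵 𝒴 𝓛)) = ‖∫ o, h o ∂(Q : Measure (Obs 𝒵 𝒴 𝓛)) -
        ∫ o, h o ∂(P : Measure (Obs 𝒵 𝒴 𝓛))‖ₑ := by
    rw [← e2, ← e1, zero_sub, enorm_neg, eLpNorm_one_eq_lintegral_enorm,
      ← ofReal_integral_norm_eq_lintegral_enorm hi, Real.enorm_eq_ofReal]
    · congr 1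
      refine integral_congr_ae (.of_forall fun o => ?_)
      simp only [hg]
      split_ifs with h0
      · rw [one_mul, Real.norm_of_nonneg h0]
      · rw [Real.norm_of_nonpos (not_le.1 h0).le]; ring
    · refine integral_nonneg fun o => ?_
      simp only [hg]
      split_ifs with h0
      · simpa using h0
      · simp only [Pi.zero_apply]; push Not at h0; linarith
  rw [e3]
  have lP := hle P
  have lQ := hle Q
  have : IsFiniteMeasure (densMeasure μ p) := hP ▸ inferInstance
  have : IsFiniteMeasure (densMeasure μ q) := hQ ▸ inferInstance
  rw [hP] at lP ⊢
  rw [hQ] at lQ ⊢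
  refine (enorm_integral_densMeasure_sub_le hp hp0 hq hq0 mh (lP.trans_lt ENNReal.ofReal_lt_top)
    (lQ.trans_lt ENNReal.ofReal_lt_top)).trans ?_
  gcongr

variable (P Q : ProbabilityMeasure (Obs 𝒵 𝒴 𝓛))

theorem eLpNorm_indicator_le_of_dominated {E : Set 𝓛} (hE : MeasurableSet E)
    (hd : ∀ t, MeasurableSet t → t ⊆ E → lawL Q t ≤ 4 * lawL P t) {f : 𝓛 → ℝ}
    (hf : Measurable f) :
    eLpNorm (fun o => E.indicator f o.L) 2 (Q : Measure (Obs 𝒵 𝒴 𝓛)) ≤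
      2 * eLpNorm (fun o => f o.L) 2 (P : Measure (Obs 𝒵 𝒴 𝓛)) := by
  have e1 : eLpNorm (E.indicator f) 2 (lawL Q) =
      eLpNorm (fun o => E.indicator f o.L) 2 (Q : Measure (Obs 𝒵 𝒴 𝓛)) :=
    eLpNorm_map_measure (hf.indicator hE).aestronglyMeasurable (by fun_prop)
  have e2 : eLpNorm f 2 (lawL P) = eLpNorm (fun o => f o.L) 2 (P : Measure (Obs 𝒵 𝒴 𝓛)) :=
    eLpNorm_map_measure hf.aestronglyMeasurable (by fun_prop)
  rw [← e1, ← e2, eLpNorm_indicator_eq_eLpNorm_restrict hE]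
  have hle : (lawL Q).restrict E ≤ (4 : ℝ≥0∞) • lawL P := by
    refine Measure.le_iff.2 fun t ht => ?_
    rw [Measure.restrict_apply ht]
    refine (hd _ (ht.inter hE) Set.inter_subset_right).trans ?_
    rw [Measure.smul_apply, smul_eq_mul]
    gcongr
    exact Set.inter_subset_left
  refine (eLpNorm_mono_measure f hle).trans_eq ?_
  rw [eLpNorm_smul_measure_of_ne_top (by norm_num)]
  have h2 : (4 : ℝ≥0∞) ^ (1 / 2 : ℝ) = 2 := by
    rw [show (4 : ℝ≥0∞) = 2 ^ (2 : ℝ) by norm_num, ← ENNReal.rpow_mul]; norm_num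
  have h3 : (4 : ℝ≥0∞) ^ (1 / (2 : ℝ≥0∞)).toReal = 2 := by
    rw [show (1 / (2 : ℝ≥0∞)).toReal = 1 / 2 by simp]; exact h2
  rw [smul_eq_mul, h3]

/-- The function whose means under `Q` and `P` differ by `psi π Q - psi π P`, up to the
contribution of `Eᶜ`. -/
def gradFun (π : 𝒵 → 𝓛 → ℝ) (e : ℝ) (E : Set 𝓛) (o : Obs 𝒵 𝒴 𝓛) : ℝ :=
  E.indicator (trueNuisance π P).γ o.L +
    E.indicator (fun l => clipInv e ((trueNuisance π Q).κ l)) o.L *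
      ((wt π o - (trueNuisance π Q).ρ o.L) * residual (trueNuisance π P) o)

variable {C ε e : ℝ} (hε : 0 < ε) (he : 0 < e) (hπm : Measurable (Function.uncurry π))
  (hC : ∀ z l, |π z l| ≤ C)

include hπm in
theorem measurable_gradFun {E : Set 𝓛} (hE : MeasurableSet E) :
    Measurable (gradFun P Q π e E) := by
  have h1 := measurable_trueNuisance_γ P hπm
  have h2 := measurable_trueNuisance_κ Q hπm
  have h3 := measurable_trueNuisance_ρ Q hπm
  have h4 := measurable_residual P hπm
  have h5 := measurable_wt (𝒴 := 𝒴) hπm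
  exact ((h1.indicator hE).comp Obs.measurable_L).add
    ((((((measurable_clipInv e).comp h2).indicator hE).comp Obs.measurable_L)).mul
      ((h5.sub (h3.comp Obs.measurable_L)).mul h4))

theorem abs_indicator_clipInv_le (he : 0 < e) (E : Set 𝓛) (f : 𝓛 → ℝ) (l : 𝓛) :
    |E.indicator (fun l => clipInv e (f l)) l| ≤ e⁻¹ := by
  by_cases hl : l ∈ E
  · simpa [hl] using abs_clipInv_le he _
  · simpa [hl] using he.le

include he hπm hC in
theorem eLpNorm_gradFun_le {E : Set 𝓛} (hE : MeasurableSet E)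
    (ν : Measure (Obs 𝒵 𝒴 𝓛)) :
    eLpNorm (gradFun P Q π e E) 2 ν ≤ ENNReal.ofReal (1 + 2 * C / e) * (eLpNorm Obs.Y 2 ν +
      2 * eLpNorm (fun o => E.indicator (envelope (trueNuisance π P)) o.L) 2 ν) := by
  have hM := measurable_envelope P hπm
  have hb : ∀ o : Obs 𝒵 𝒴 𝓛, ‖gradFun P Q π e E o‖ ≤ (1 + 2 * C / e) *
      ‖|o.Y| + (2 : ℝ) • E.indicator (envelope (trueNuisance π P)) o.L‖ := fun o => by
    have hC0 : 0 ≤ C := (abs_nonneg _).trans (hC o.Z o.L)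
    by_cases ho : o.L ∈ E
    · have h1 : |(trueNuisance π P).γ o.L| ≤ envelope (trueNuisance π P) o.L :=
        le_add_of_nonneg_right (abs_nonneg _)
      have h0 : 0 ≤ envelope (trueNuisance π P) o.L := (abs_nonneg _).trans h1
      have h2 := abs_residual_le (π := π) P o
      have h3 : |wt π o - (trueNuisance π Q).ρ o.L| ≤ 2 * C := by
        have := abs_sub (wt π o) ((trueNuisance π Q).ρ o.L)
        have := abs_trueNuisance_ρ_le Q hC o.L
        have : |wt π o| ≤ C := hC _ _
        linarith
      have h4 := abs_clipInv_le he ((trueNuisance π Q).κ o.L)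
      simp only [gradFun, Set.indicator_of_mem ho, smul_eq_mul]
      have hr : ‖|o.Y| + 2 * envelope (trueNuisance π P) o.L‖ =
        |o.Y| + 2 * envelope (trueNuisance π P) o.L := Real.norm_of_nonneg (by positivity)
      rw [hr]
      refine (norm_add_le _ _).trans ?_
      simp only [norm_mul, Real.norm_eq_abs]
      calc _ ≤ envelope (trueNuisance π P) o.L + e⁻¹ * (2 * C *
            (|o.Y| + 2 * envelope (trueNuisance π P) o.L)) := by gcongr
        _ ≤ (|o.Y| + 2 * envelope (trueNuisance π P) o.L) + e⁻¹ * (2 * C *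
            (|o.Y| + 2 * envelope (trueNuisance π P) o.L)) := by
          have := abs_nonneg o.Y
          gcongr; linarith
        _ = _ := by field_simp
    · simp only [gradFun, Set.indicator_of_notMem ho]
      simp only [zero_mul, add_zero, norm_zero]
      positivity
  refine (eLpNorm_le_mul_eLpNorm_of_ae_le_mul (.of_forall hb) 2).trans
    (mul_le_mul_right ?_ _)
  have mE : Measurable fun o : Obs 𝒵 𝒴 𝓛 => E.indicator (envelope (trueNuisance π P)) o.L :=
    (hM.indicator hE).comp Obs.measurable_L
  refine (eLpNorm_add_le (by fun_prop) (mE.const_smul (2 : ℝ)).aestronglyMeasurable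
    (by norm_num)).trans (add_le_add ?_ ?_)
  · exact (eLpNorm_norm Obs.Y).le
  · exact (eLpNorm_const_smul_le (c := (2 : ℝ))
      (f := fun o : Obs 𝒵 𝒴 𝓛 => E.indicator (envelope (trueNuisance π P)) o.L)).trans_eq
      (by congr 1; simp [enorm_eq_nnnorm])

include hε he hπm hC in
theorem psi_sub_psi (hYP : MemLp Obs.Y 2 (P : Measure (Obs 𝒵 𝒴 𝓛)))
    (hYQ : MemLp Obs.Y 2 (Q : Measure (Obs 𝒵 𝒴 𝓛))) (hP : RelevanceBound π ε P)
    (hQ : RelevanceBound π e Q) {E : Set 𝓛} (hE : MeasurableSet E)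
    (hd : ∀ t, MeasurableSet t → t ⊆ E → lawL Q t ≤ 4 * lawL P t) :
    psi π Q - psi π P =
      (∫ o, gradFun P Q π e E o ∂(Q : Measure (Obs 𝒵 𝒴 𝓛)) -
        ∫ o, gradFun P Q π e E o ∂(P : Measure (Obs 𝒵 𝒴 𝓛))) +
      (∫ o, Eᶜ.indicator (fun _ => (1 : ℝ)) (Obs.L o) * (trueNuisance π Q).γ o.L
          ∂(Q : Measure (Obs 𝒵 𝒴 𝓛)) -
        ∫ o, Eᶜ.indicator (fun _ => (1 : ℝ)) (Obs.L o) * (trueNuisance π P).γ o.L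
          ∂(P : Measure (Obs 𝒵 𝒴 𝓛))) := by
  have mγP := measurable_trueNuisance_γ P hπm
  have mγQ := measurable_trueNuisance_γ Q hπm
  have mk : Measurable (E.indicator (fun l => clipInv e ((trueNuisance π Q).κ l))) :=
    ((measurable_clipInv e).comp (measurable_trueNuisance_κ Q hπm)).indicator hE
  have mρ := measurable_trueNuisance_ρ Q hπm
  have hk := abs_indicator_clipInv_le he E (trueNuisance π Q).κ
  have lP := memLp_γ P hε hπm hC hYP hP
  have lQ := memLp_γ Q he hπm hC hYQ hQ
  -- decomposition of `psi`
  have split : ∀ R : ProbabilityMeasure (Obs 𝒵 𝒴 𝓛),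
      MemLp (fun o => (trueNuisance π R).γ o.L) 2 (R : Measure (Obs 𝒵 𝒴 𝓛)) →
      psi π R = ∫ o : Obs 𝒵 𝒴 𝓛, E.indicator (trueNuisance π R).γ o.L
          ∂(R : Measure (Obs 𝒵 𝒴 𝓛)) +
        ∫ o : Obs 𝒵 𝒴 𝓛, Eᶜ.indicator (fun _ => (1 : ℝ)) o.L * (trueNuisance π R).γ o.L
          ∂(R : Measure (Obs 𝒵 𝒴 𝓛)) := fun R hR => by
    have hi := hR.integrable (by norm_num)
    have i1 : Integrable (fun o => E.indicator (trueNuisance π R).γ (Obs.L o))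
        (R : Measure (Obs 𝒵 𝒴 𝓛)) := hi.indicator (Obs.measurable_L hE)
    have i2 : Integrable (fun o => Eᶜ.indicator (fun _ => (1 : ℝ)) (Obs.L o) *
        (trueNuisance π R).γ o.L) (R : Measure (Obs 𝒵 𝒴 𝓛)) := by
      refine (hi.indicator (Obs.measurable_L hE.compl)).congr (.of_forall fun o => ?_)
      by_cases ho : o.L ∈ E <;> simp [ho]
    rw [← integral_add i1 i2]
    refine integral_congr_ae (.of_forall fun o => ?_)
    change (trueNuisance π R).γ o.L = _
    by_cases ho : o.L ∈ E <;> simp [ho]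
  have hγQ : MemLp (fun o => E.indicator (trueNuisance π P).γ (Obs.L o)) 2
      (Q : Measure (Obs 𝒵 𝒴 𝓛)) :=
    ⟨((mγP.indicator hE).comp Obs.measurable_L).aestronglyMeasurable,
      (eLpNorm_indicator_le_of_dominated P Q hE hd mγP).trans_lt
        (ENNReal.mul_lt_top (by simp) lP.2)⟩
  have hgradQ : MemLp (gradFun P Q π e E) 2 (Q : Measure (Obs 𝒵 𝒴 𝓛)) := by
    refine ⟨(measurable_gradFun P Q hπm hE).aestronglyMeasurable,
      (eLpNorm_gradFun_le P Q he hπm hC hE _).trans_lt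
        (ENNReal.mul_lt_top ENNReal.ofReal_lt_top
          (ENNReal.add_lt_top.2 ⟨hYQ.2, ENNReal.mul_lt_top (by simp) ?_⟩))⟩
    exact (eLpNorm_indicator_le_of_dominated P Q hE hd (measurable_envelope P hπm)).trans_lt
      (ENNReal.mul_lt_top (by simp) (memLp_envelope P hε hπm hC hYP hP).2)
  have hresQ : MemLp (fun o => E.indicator (fun l => clipInv e ((trueNuisance π Q).κ l)) o.L *
      ((wt π o - (trueNuisance π Q).ρ o.L) * residual (trueNuisance π P) o)) 2
      (Q : Measure (Obs 𝒵 𝒴 𝓛)) :=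
    (memLp_congr_ae (.of_forall fun o => add_sub_cancel_left _ _)).1 (hgradQ.sub hγQ)
  have iγQ := hγQ.integrable (by norm_num)
  have iγP : Integrable (fun o => E.indicator (trueNuisance π P).γ (Obs.L o))
      (P : Measure (Obs 𝒵 𝒴 𝓛)) :=
    (lP.integrable (by norm_num)).indicator (Obs.measurable_L hE)
  have eP : ∫ o, gradFun P Q π e E o ∂(P : Measure (Obs 𝒵 𝒴 𝓛)) =
      ∫ o, E.indicator (trueNuisance π P).γ (Obs.L o) ∂(P : Measure (Obs 𝒵 𝒴 𝓛)) := by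
    have h := integral_mul_residual_eq_zero P hε hπm hC hYP hP mk mρ
      (abs_trueNuisance_ρ_le Q hC) (.of_forall fun o => hk _)
    refine (integral_add iγP ((memLp_mul_residual hπm hC mk mρ (abs_trueNuisance_ρ_le Q hC)
      (.of_forall fun o => hk _) (memLp_residual P hε hπm hC hYP hP)).integrable
        (by norm_num))).trans ?_
    rw [h, add_zero]
  have eQ : ∫ o, gradFun P Q π e E o ∂(Q : Measure (Obs 𝒵 𝒴 𝓛)) =
      ∫ o, E.indicator (trueNuisance π Q).γ (Obs.L o) ∂(Q : Measure (Obs 𝒵 𝒴 𝓛)) := by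
    have h := integral_mul_residual Q hπm hC hYQ mk mρ mγP
      (measurable_trueNuisance_η P) (measurable_trueNuisance_δ P)
      (hresQ.integrable (by norm_num))
    have i3 : Integrable (fun o => E.indicator (trueNuisance π Q).γ (Obs.L o))
        (Q : Measure (Obs 𝒵 𝒴 𝓛)) :=
      (lQ.integrable (by norm_num)).indicator (Obs.measurable_L hE)
    refine (integral_add iγQ (hresQ.integrable (by norm_num))).trans ?_
    rw [h, add_comm, ← eq_sub_iff_add_eq, ← integral_sub i3 iγQ]
    refine integral_congr_ae ?_
    filter_upwards [ae_of_ae_lawL Q hQ.ae_le] with o ho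
    by_cases hoE : o.L ∈ E
    · have h0 : condCov Q Obs.A (wt π) o.L ≠ 0 := by
        intro h; rw [h, abs_zero] at ho; linarith
      have hc : clipInv e (condCov Q Obs.A (wt π) o.L) = (condCov Q Obs.A (wt π) o.L)⁻¹ :=
        if_pos ho
      simp only [Set.indicator_of_mem hoE, trueNuisance, hc, sub_self, zero_mul, add_zero]
      field_simp
    · simp [Set.indicator_of_notMem hoE]
  rw [split Q lQ, split P lP, eP, eQ]
  ring

end Pair
end IV

namespace Semiparametric

variable {X : Type*} [MeasurableSpace X] {μ : Measure X} {P : ℕ → X → ℝ} {p₀ s : X → ℝ}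
  {t : ℕ → ℝ}

/-- Scores have mean zero. -/
theorem QMDSeq.integral_score (h : QMDSeq μ P p₀ s t)
    (h0 : IsProbabilityMeasure (densMeasure μ p₀))
    (hn : ∀ n, IsProbabilityMeasure (densMeasure μ (P n))) :
    ∫ x, s x ∂(densMeasure μ p₀) = 0 := by
  have hle : ∀ ν : Measure X, IsProbabilityMeasure ν →
      eLpNorm (fun _ : X => (1 : ℝ)) 2 ν ≤ (1 : ℝ≥0) := fun ν _ => by
    rw [eLpNorm_const _ (by norm_num) (NeZero.ne ν)]; simp
  have := h.tendsto_integral_slope (T := fun _ _ => 1) (T₀ := fun _ => 1) (C := 1)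
    (fun _ => measurable_const) (fun n => hle _ (hn n)) (fun _ => hle _ h0) (memLp_const 1)
    (.of_forall fun _ => tendsto_const_nhds)
  simp only [integral_const, probReal_univ, sub_self, zero_div, one_mul] at this
  exact (tendsto_nhds_unique this tendsto_const_nhds)

end Semiparametric

namespace IV

open Semiparametric

section Derivative

variable {𝒵 : Type*} {𝒴 : Set ℝ} {𝓛 : Type*} [MeasurableSpace 𝒵] [MeasurableSpace 𝓛]
  [StandardBorelSpace 𝒵] [Nonempty 𝒵] [StandardBorelSpace 𝒴] [Nonempty 𝒴]
  [StandardBorelSpace 𝓛] [Nonempty 𝓛] {π : 𝒵 → 𝓛 → ℝ}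

theorem tendsto_div_of_enorm_le {f t : ℕ → ℝ} {N : ℕ → ℝ≥0∞} {D : ℝ≥0∞} (hD : D ≠ ∞)
    (h0 : ∀ n, t n ≠ 0)
    (hf : ∀ n, ‖f n‖ₑ ≤ N n * D) (hN : Tendsto (fun n => N n / ‖t n‖ₑ) atTop (𝓝 0)) :
    Tendsto (fun n => f n / t n) atTop (𝓝 0) := by
  rw [tendsto_zero_iff_enorm_tendsto_zero]
  refine tendsto_of_tendsto_of_tendsto_of_le_of_le tendsto_const_nhds
    (h := fun n => N n / ‖t n‖ₑ * D) ?_ (fun _ => zero_le) fun n => ?_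
  · simpa using ENNReal.Tendsto.mul_const hN (Or.inr hD)
  · have e : ‖f n / t n‖ₑ = ‖f n‖ₑ / ‖t n‖ₑ := by
      rw [div_eq_mul_inv, enorm_mul, enorm_inv (h0 n), ENNReal.div_eq_inv_mul, mul_comm]
    change ‖f n / t n‖ₑ ≤ N n / ‖t n‖ₑ * D
    rw [e, mul_comm (N n / _), ← mul_div_assoc, mul_comm D]
    exact ENNReal.div_le_div_right (hf n) _

theorem condCov_A_wt (Q : ProbabilityMeasure (Obs 𝒵 𝒴 𝓛))
    (hπm : Measurable (Function.uncurry π)) {C : ℝ} (hC : ∀ z l, |π z l| ≤ C) (a : Fin 2)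
    (l : 𝓛) :
    condCov Q (Obs.indA a) (wt π) l = condMean Q (fun o => Obs.indA a o * wt π o) l -
      condMean Q (Obs.indA a) l * condMean Q (wt π) l :=
  condCov_eq_sub Q (memLp_of_abs_le (by fun_prop) (Obs.abs_indA_le a) 2)
    (memLp_of_abs_le (measurable_wt hπm) (fun _ => hC _ _) 2)

theorem exists_seq_tendsto_psi_slope {μ : Measure (Obs 𝒵 𝒴 𝓛)} {p : ℕ → Obs 𝒵 𝒴 𝓛 → ℝ}
    {p₀ s : Obs 𝒵 𝒴 𝓛 → ℝ} {t : ℕ → ℝ} (h : QMDSeq μ p p₀ s t)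
    {P : ProbabilityMeasure (Obs 𝒵 𝒴 𝓛)} {Q : ℕ → ProbabilityMeasure (Obs 𝒵 𝒴 𝓛)}
    (hP : (P : Measure (Obs 𝒵 𝒴 𝓛)) = densMeasure μ p₀)
    (hQ : ∀ n, (Q n : Measure (Obs 𝒵 𝒴 𝓛)) = densMeasure μ (p n))
    (hYP : MemLp Obs.Y 2 (P : Measure (Obs 𝒵 𝒴 𝓛))) {K : ℝ≥0}
    (hYQ : ∀ n, eLpNorm Obs.Y 2 (Q n : Measure (Obs 𝒵 𝒴 𝓛)) ≤ K)
    {ε e C : ℝ} (he : 0 < e) (heε : e < ε) (hrP : RelevanceBound π ε P)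
    (hrQ : ∀ n, RelevanceBound π e (Q n)) (hπm : Measurable (Function.uncurry π))
    (hC : ∀ z l, |π z l| ≤ C) :
    ∃ k : ℕ → ℕ, Tendsto (fun n => (psi π (Q (k n)) - psi π P) / t (k n)) atTop
      (𝓝 (∫ o, phi π (psi π P) (trueNuisance π P) o * s o ∂(P : Measure (Obs 𝒵 𝒴 𝓛)))) := by
  have hε : 0 < ε := he.trans heε
  have hw := measurable_wt (𝒴 := 𝒴) hπm
  have hwC : ∀ o : Obs 𝒵 𝒴 𝓛, |wt π o| ≤ C := fun o => hC _ _
  have hYQm : ∀ n, MemLp Obs.Y 2 (Q n : Measure (Obs 𝒵 𝒴 𝓛)) := fun n =>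
    ⟨Obs.measurable_Y.aestronglyMeasurable, (hYQ n).trans_lt (by simp)⟩
  -- the sets on which `Q n` has at least four times the mass of `P`
  have hahn : ∀ n, ∃ B : Set 𝓛, MeasurableSet B ∧
      (∀ r, MeasurableSet r → r ⊆ B → 4 * lawL P r ≤ lawL (Q n) r) ∧
      ∀ r, MeasurableSet r → r ⊆ Bᶜ → lawL (Q n) r ≤ 4 * lawL P r := fun n => by
    have : IsFiniteMeasure ((4 : ℝ≥0∞) • lawL P) := ⟨by simp⟩
    exact hahn_decomposition (lawL (Q n)) ((4 : ℝ≥0∞) • lawL P)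
  choose B hBm hB4 hBd using hahn
  have hLB : ∀ n, MeasurableSet (Obs.L ⁻¹' B n : Set (Obs 𝒵 𝒴 𝓛)) := fun n =>
    Obs.measurable_L (hBm n)
  have hLB4 : ∀ n, 4 * densMeasure μ p₀ (Obs.L ⁻¹' B n) ≤ densMeasure μ (p n) (Obs.L ⁻¹' B n) := by
    intro n
    rw [← hP, ← hQ n]
    have := hB4 n _ (hBm n) subset_rfl
    rwa [lawL, lawL, Measure.map_apply Obs.measurable_L (hBm n),
      Measure.map_apply Obs.measurable_L (hBm n)] at this
  obtain ⟨hN, hNt⟩ := h.tendsto_sqrt_measure_div hLB hLB4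
  set N : ℕ → ℝ≥0∞ := fun n => eLpNorm ((Obs.L ⁻¹' B n).indicator fun _ => (1 : ℝ)) 2
    (densMeasure μ (p n)) with hNdef
  have hN0 : ∀ n, eLpNorm ((Obs.L ⁻¹' B n).indicator fun _ => (1 : ℝ)) 2
      (P : Measure (Obs 𝒵 𝒴 𝓛)) ≤ N n := fun n => by
    rw [hP]
    exact (eLpNorm_indicator_one_le_half (hLB n) (hLB4 n)).trans ENNReal.half_le_self
  -- almost sure convergence along a subsequence
  have hL1 : ∀ f : Obs 𝒵 𝒴 𝓛 → ℝ, Measurable f → ∀ D : ℝ, (∀ o, |f o| ≤ D) →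
      Tendsto (fun n => eLpNorm (fun o => condMean (Q n) f o.L - condMean P f o.L) 1
        (P : Measure (Obs 𝒵 𝒴 𝓛))) atTop (𝓝 0) := fun f hf D hD => by
    refine tendsto_of_tendsto_of_tendsto_of_le_of_le tendsto_const_nhds ?_ (fun _ => zero_le)
      fun n => eLpNorm_condMean_sub_le h.meas₀ h.nonneg₀ (h.meas n) (h.nonneg n) hP (hQ n) hf hD
    simpa using ENNReal.Tendsto.const_mul h.tendsto_hellinger
      (a := ENNReal.ofReal (2 * D) + ENNReal.ofReal (2 * D))
      (Or.inr (ENNReal.add_ne_top.2 ⟨ENNReal.ofReal_ne_top, ENNReal.ofReal_ne_top⟩))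
  have hconv : ∃ k : ℕ → ℕ, StrictMono k ∧ ∀ᵐ o ∂(P : Measure (Obs 𝒵 𝒴 𝓛)), ∀ i : Fin 4,
      Tendsto (fun n => (![
        fun n o => condMean (Q n) (wt π) (Obs.L o) - condMean P (wt π) o.L,
        fun n o => condMean (Q n) (Obs.indA 1) (Obs.L o) - condMean P (Obs.indA 1) o.L,
        fun n o => condMean (Q n) (fun o => Obs.indA 1 o * wt π o) (Obs.L o) -
          condMean P (fun o => Obs.indA 1 o * wt π o) o.L,
        fun n => (Obs.L ⁻¹' B n).indicator fun _ => (1 : ℝ)] : Fin 4 → ℕ → Obs 𝒵 𝒴 𝓛 → ℝ)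
          i (k n) o) atTop (𝓝 0) := by
    have mm : ∀ n (f : Obs 𝒵 𝒴 𝓛 → ℝ), Measurable f → AEStronglyMeasurable
        (fun o => condMean (Q n) f (Obs.L o) - condMean P f o.L)
        (P : Measure (Obs 𝒵 𝒴 𝓛)) := fun n f hf => by
      have := measurable_condMean (Q n) hf
      have := measurable_condMean P hf
      exact Measurable.aestronglyMeasurable (by fun_prop)
    refine exists_seq_forall_tendsto_ae (fun i n => ?_) fun i => ?_
    · fin_cases i
      · exact mm n _ hw
      · exact mm n _ (by fun_prop)
      · exact mm n _ (by fun_prop)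
      · exact (measurable_const.indicator (hLB n)).aestronglyMeasurable
    · fin_cases i
      · exact hL1 _ hw C hwC
      · exact hL1 _ (by fun_prop) 1 (Obs.abs_indA_le 1)
      · refine hL1 _ (by fun_prop) (1 * C) fun o => ?_
        rw [abs_mul]
        exact mul_le_mul (Obs.abs_indA_le 1 o) (hwC o) (abs_nonneg _) zero_le_one
      · refine tendsto_of_tendsto_of_tendsto_of_le_of_le tendsto_const_nhds hN
          (fun _ => zero_le) fun n => ?_
        exact (eLpNorm_le_eLpNorm_of_exponent_le (by norm_num)
          (measurable_const.indicator (hLB n)).aestronglyMeasurable).trans (hN0 n)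
  obtain ⟨k, hk, hka⟩ := hconv
  refine ⟨k, ?_⟩
  have hk' := h.comp hk.tendsto_atTop
  -- the uniform `L²` bound
  set M := eLpNorm (fun o : Obs 𝒵 𝒴 𝓛 => envelope (trueNuisance π P) o.L) 2
    (P : Measure (Obs 𝒵 𝒴 𝓛)) with hM
  have hMtop : M < ∞ := (memLp_envelope P hε hπm hC hYP hrP).2
  have hYtop := hYP.2
  set D : ℝ≥0∞ := ENNReal.ofReal (1 + 2 * C / e) *
    (max (K : ℝ≥0∞) (eLpNorm Obs.Y 2 (P : Measure (Obs 𝒵 𝒴 𝓛))) + 2 * (2 * M)) with hD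
  have hDtop : D ≠ ∞ := by
    refine ENNReal.mul_ne_top ENNReal.ofReal_ne_top (ENNReal.add_ne_top.2 ⟨?_, ?_⟩)
    · exact (max_lt (by simp) hYtop).ne
    · exact ENNReal.mul_ne_top (by simp) (ENNReal.mul_ne_top (by simp) hMtop.ne)
  have hgP : ∀ n, eLpNorm (gradFun P (Q n) π e (B n)ᶜ) 2 (P : Measure (Obs 𝒵 𝒴 𝓛)) ≤ D :=
    fun n => by
    refine (eLpNorm_gradFun_le P (Q n) he hπm hC (hBm n).compl _).trans ?_
    refine mul_le_mul_right (add_le_add (le_max_right _ _) (mul_le_mul_right ?_ _)) _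
    refine le_trans (eLpNorm_mono fun o => ?_) (le_mul_of_one_le_left' (by norm_num))
    exact norm_indicator_le_norm_self (envelope (trueNuisance π P)) o.L
  have hgQ : ∀ n, eLpNorm (gradFun P (Q n) π e (B n)ᶜ) 2 (Q n : Measure (Obs 𝒵 𝒴 𝓛)) ≤ D :=
    fun n => by
    refine (eLpNorm_gradFun_le P (Q n) he hπm hC (hBm n).compl _).trans ?_
    refine mul_le_mul_right (add_le_add ((hYQ n).trans (le_max_left _ _))
      (mul_le_mul_right ?_ _)) _
    exact eLpNorm_indicator_le_of_dominated P (Q n) (hBm n).compl (hBd n)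
      (measurable_envelope P hπm)
  have hphi := memLp_phi P hε hπm hC hYP hrP (psi π P)
  have hmain := hk'.tendsto_integral_slope
    (T := fun n => gradFun P (Q (k n)) π e (B (k n))ᶜ)
    (T₀ := fun o => phi π (psi π P) (trueNuisance π P) o + psi π P) (C := D.toNNReal)
    (fun n => measurable_gradFun P _ hπm (hBm _).compl)
    (fun n => by
      rw [ENNReal.coe_toNNReal hDtop]
      have := hgQ (k n)
      rwa [hQ] at this)
    (fun n => by
      rw [ENNReal.coe_toNNReal hDtop]
      have := hgP (k n)
      rwa [hP] at this)
    (by rw [← hP]; exact hphi.add (memLp_const _))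
    (by
      rw [← hP]
      filter_upwards [hka, ae_of_ae_lawL P hrP.ae_le] with o ho hκ
      have h0 := ho 0
      have h1 := ho 1
      have h2 := ho 2
      have h3 := ho 3
      simp only [Matrix.cons_val] at h0 h1 h2 h3
      have h0' := tendsto_sub_nhds_zero_iff.1 h0
      have h1' := tendsto_sub_nhds_zero_iff.1 h1
      have h2' := tendsto_sub_nhds_zero_iff.1 h2
      have hκt : Tendsto (fun n => condCov (Q (k n)) Obs.A (wt π) o.L) atTop
          (𝓝 (condCov P Obs.A (wt π) o.L)) := by
        rw [← Obs.indA_one]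
        simp_rw [condCov_A_wt _ hπm hC]
        exact h2'.sub (h1'.mul h0')
      have hinv := (tendsto_clipInv he (heε.trans_le hκ)).comp hκt
      have hlim : Tendsto (fun n => (trueNuisance π P).γ o.L +
          clipInv e (condCov (Q (k n)) Obs.A (wt π) o.L) *
          ((wt π o - condMean (Q (k n)) (wt π) o.L) * residual (trueNuisance π P) o)) atTop
          (𝓝 (phi π (psi π P) (trueNuisance π P) o + psi π P)) := by
        rw [phi_eq, sub_add_cancel]
        exact tendsto_const_nhds.add
          (hinv.mul ((tendsto_const_nhds.sub h0').mul tendsto_const_nhds))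
      refine hlim.congr' ?_
      filter_upwards [h3.eventually_lt_const one_pos] with n hn
      have hnB : o.L ∈ (B (k n))ᶜ := by
        intro hB
        rw [Set.indicator_of_mem (show o ∈ Obs.L ⁻¹' B (k n) from hB)] at hn
        exact lt_irrefl _ hn
      simp only [gradFun, Set.indicator_of_mem hnB]
      rfl)
  rw [← hP] at hmain
  have hs0 : ∫ o, s o ∂(P : Measure (Obs 𝒵 𝒴 𝓛)) = 0 := by
    rw [hP]
    exact h.integral_score (hP ▸ inferInstance) fun n => hQ n ▸ inferInstance
  have hsm : MemLp s 2 (P : Measure (Obs 𝒵 𝒴 𝓛)) := hP ▸ h.score_memLp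
  have hlim_eq : ∫ o, (phi π (psi π P) (trueNuisance π P) o + psi π P) * s o
      ∂(P : Measure (Obs 𝒵 𝒴 𝓛)) =
      ∫ o, phi π (psi π P) (trueNuisance π P) o * s o ∂(P : Measure (Obs 𝒵 𝒴 𝓛)) := by
    simp_rw [add_mul]
    have i1 : Integrable (fun o => phi π (psi π P) (trueNuisance π P) o * s o)
      (P : Measure (Obs 𝒵 𝒴 𝓛)) := hphi.integrable_mul hsm
    rw [integral_add i1 ((hsm.integrable (by norm_num)).const_mul _), integral_const_mul, hs0]
    simp
  rw [hlim_eq] at hmain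
  -- the exceptional sets
  have mind : ∀ n, AEStronglyMeasurable (fun o : Obs 𝒵 𝒴 𝓛 =>
      (B n)ᶜᶜ.indicator (fun _ => (1 : ℝ)) o.L) (Q n : Measure (Obs 𝒵 𝒴 𝓛)) := fun n =>
    ((measurable_const.indicator (hBm n).compl.compl).comp
      Obs.measurable_L).aestronglyMeasurable
  have mind0 : ∀ n, AEStronglyMeasurable (fun o : Obs 𝒵 𝒴 𝓛 =>
      (B n)ᶜᶜ.indicator (fun _ => (1 : ℝ)) o.L) (P : Measure (Obs 𝒵 𝒴 𝓛)) := fun n =>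
    ((measurable_const.indicator (hBm n).compl.compl).comp
      Obs.measurable_L).aestronglyMeasurable
  have eind : ∀ n, (fun o : Obs 𝒵 𝒴 𝓛 => (B n)ᶜᶜ.indicator (fun _ => (1 : ℝ)) o.L) =
      (Obs.L ⁻¹' B n).indicator fun _ => (1 : ℝ) := fun n => by
    rw [compl_compl]; rfl
  have hexQ : Tendsto (fun n => (∫ o, (B n)ᶜᶜ.indicator (fun _ => (1 : ℝ)) (Obs.L o) *
      (trueNuisance π (Q n)).γ o.L ∂(Q n : Measure (Obs 𝒵 𝒴 𝓛))) / t n) atTop (𝓝 0) := by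
    refine tendsto_div_of_enorm_le (D := ENNReal.ofReal (2 * C / e) * K)
      (ENNReal.mul_ne_top ENNReal.ofReal_ne_top (by simp)) h.ne_zero (fun n => ?_) hNt
    refine (enorm_integral_mul_le (mind n) (memLp_γ (Q n) he hπm hC (hYQm n) (hrQ n)).1).trans
      (mul_le_mul' ?_ ((eLpNorm_γ_le (Q n) he hπm hC (hYQm n) (hrQ n)).trans
        (mul_le_mul_right (hYQ n) _)))
    rw [eind, hQ n]
  have hexP : Tendsto (fun n => (∫ o, (B n)ᶜᶜ.indicator (fun _ => (1 : ℝ)) (Obs.L o) *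
      (trueNuisance π P).γ o.L ∂(P : Measure (Obs 𝒵 𝒴 𝓛))) / t n) atTop (𝓝 0) := by
    refine tendsto_div_of_enorm_le (memLp_γ P hε hπm hC hYP hrP).2.ne h.ne_zero
      (fun n => ?_) hNt
    refine (enorm_integral_mul_le (mind0 n) (memLp_γ P hε hπm hC hYP hrP).1).trans
      (mul_le_mul_left ?_ _)
    rw [eind]; exact hN0 n
  have hfinal := hmain.add ((hexQ.comp hk.tendsto_atTop).sub (hexP.comp hk.tendsto_atTop))
  rw [sub_zero, add_zero] at hfinal
  refine hfinal.congr fun n => ?_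
  rw [psi_sub_psi P (Q (k n)) hε he hπm hC hYP (hYQm _) hrP (hrQ _) (hBm (k n)).compl
    (hBd (k n))]
  simp only [Function.comp_apply]
  rw [hQ (k n)]
  ring

theorem hasDerivAt_psi {P : ProbabilityMeasure (Obs 𝒵 𝒴 𝓛)}
    (hY : MemLp Obs.Y 2 (P : Measure (Obs 𝒵 𝒴 𝓛))) (hπ : IsRWF P π)
    {Pt : ℝ → ProbabilityMeasure (Obs 𝒵 𝒴 𝓛)} {s : Obs 𝒵 𝒴 𝓛 → ℝ}
    (hs : IsRegularSubmodel π P Pt s) :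
    HasDerivAt (fun θ : ℝ => psi π (Pt θ))
      (∫ o, phi π (psi π P) (trueNuisance π P) o * s o ∂(P : Measure (Obs 𝒵 𝒴 𝓛))) 0 := by
  obtain ⟨⟨h0, hsL, μ, -, p, hpm, hp0, hPt, hqmd⟩, K, e, he, hmodel⟩ := hs
  obtain ⟨C, hC⟩ := hπ.bounded
  obtain ⟨ε, hε, hrP⟩ := hπ.relevance
  have hP : (P : Measure (Obs 𝒵 𝒴 𝓛)) = densMeasure μ (p 0) := by rw [← h0]; exact hPt 0
  obtain ⟨s', hs', hss'⟩ := hsL.1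
  have hs'm := hs'.measurable
  have hint : ∫ o, phi π (psi π P) (trueNuisance π P) o * s o ∂(P : Measure (Obs 𝒵 𝒴 𝓛)) =
      ∫ o, phi π (psi π P) (trueNuisance π P) o * s' o ∂(P : Measure (Obs 𝒵 𝒴 𝓛)) :=
    integral_congr_ae (by filter_upwards [hss'] with o ho; rw [ho])
  have hμ : ∀ᵐ x ∂μ, s x * √(p 0 x) = s' x * √(p 0 x) := by
    have := hss'
    rw [hP, densMeasure, Filter.EventuallyEq, ae_withDensity_iff (by have := hpm 0; fun_prop)]
      at this
    filter_upwards [this] with x hx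
    by_cases hx0 : p 0 x = 0
    · simp [hx0]
    · rw [hx (by simpa using lt_of_le_of_ne (hp0 0 x) (Ne.symm hx0))]
  rw [hint, hasDerivAt_iff_tendsto_slope_zero]
  refine tendsto_of_subseq_tendsto fun ns hns => ?_
  have hns0 := tendsto_nhdsWithin_iff.1 hns
  obtain ⟨m, hm⟩ := eventually_atTop.1 ((hns0.1.eventually hmodel).and hns0.2)
  set t : ℕ → ℝ := fun n => ns (n + m) with ht
  have htend : Tendsto t atTop (𝓝[≠] 0) := hns.comp (tendsto_add_atTop_nat m)
  have hrel : ∀ {a b : ℝ} {R : ProbabilityMeasure (Obs 𝒵 𝒴 𝓛)}, a ≤ b →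
      RelevanceBound π b R → RelevanceBound π a R := fun hab hR i => by
    filter_upwards [hR i] with l hl using hab.trans hl
  have hQ : QMDSeq μ (fun n => p (t n)) (p 0) s' t :=
    { meas := fun n => hpm _
      nonneg := fun n => hp0 _
      meas₀ := hpm 0
      nonneg₀ := hp0 0
      fin := fun n => by
        have := hPt (t n); rw [densMeasure, ← this]; infer_instance
      fin₀ := hP ▸ inferInstance
      score_meas := hs'm
      score_memLp := hP ▸ hsL.ae_eq hss'
      ne_zero := fun n => (hm (n + m) (Nat.le_add_left _ _)).2
      tendsto_zero := htend.mono_right nhdsWithin_le_nhds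
      tendsto := by
        refine (hqmd.comp htend).congr fun n => eLpNorm_congr_ae ?_
        filter_upwards [hμ] with x hx
        rw [hx] }
  obtain ⟨k, hk⟩ := exists_seq_tendsto_psi_slope hQ (Q := fun n => Pt (t n)) (π := π) hP
    (fun n => hPt _) hY (K := K) (fun n => (hm (n + m) (Nat.le_add_left _ _)).1.1)
    (ε := ε) (e := min e (ε / 2)) (lt_min he (half_pos hε))
    ((min_le_right _ _).trans_lt (half_lt_self hε)) hrP
    (fun n => hrel (min_le_left _ _) (hm (n + m) (Nat.le_add_left _ _)).1.2) hπ.measurable hC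
  refine ⟨fun n => k n + m, hk.congr fun n => ?_⟩
  simp only [zero_add, h0, smul_eq_mul, ht]
  rw [div_eq_inv_mul]

end Derivative
end IV

namespace Semiparametric

section Tilt

set_option linter.unusedSectionVars false

variable {X : Type*} [MeasurableSpace X]

/-- The density `1 + θ s`, for `|θ| ≤ 1/2`. -/
def tiltDens (s : X → ℝ) (θ : ℝ) (x : X) : ℝ := 1 + (if |θ| ≤ 1 / 2 then θ else 0) * s x

variable {s : X → ℝ} (hs : Measurable s) (h1 : ∀ x, |s x| ≤ 1)

include hs in
@[fun_prop]
theorem measurable_tiltDens (θ : ℝ) : Measurable (tiltDens s θ) := by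
  unfold tiltDens; fun_prop

theorem abs_clip_mul_le {s : X → ℝ} (h1 : ∀ x, |s x| ≤ 1) (θ : ℝ) (x : X) :
    |(if |θ| ≤ 1 / 2 then θ else 0) * s x| ≤ 1 / 2 := by
  rw [abs_mul]
  split_ifs with h
  · calc _ ≤ 1 / 2 * 1 := mul_le_mul h (h1 x) (abs_nonneg _) (by norm_num)
      _ = _ := by norm_num
  · simp

include h1 in
theorem tiltDens_nonneg (θ : ℝ) (x : X) : 0 ≤ tiltDens s θ x := by
  have := (abs_le.1 (abs_clip_mul_le h1 θ x)).1
  unfold tiltDens; linarith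

include h1 in
theorem tiltDens_le (θ : ℝ) (x : X) : tiltDens s θ x ≤ 4 := by
  have := (abs_le.1 (abs_clip_mul_le h1 θ x)).2
  unfold tiltDens; linarith

theorem tiltDens_zero (s : X → ℝ) : tiltDens s 0 = fun _ => 1 := by
  ext x; simp [tiltDens]

include hs h1 in
theorem isProbabilityMeasure_tilt (P : ProbabilityMeasure X)
    (h0 : ∫ x, s x ∂(P : Measure X) = 0) (θ : ℝ) :
    IsProbabilityMeasure (densMeasure (P : Measure X) (tiltDens s θ)) := by
  have hi : Integrable s (P : Measure X) :=
    Integrable.of_bound hs.aestronglyMeasurable 1 (.of_forall h1)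
  have hi2 : Integrable (tiltDens s θ) (P : Measure X) :=
    (integrable_const 1).add (hi.const_mul _)
  refine ⟨?_⟩
  rw [densMeasure, withDensity_apply _ MeasurableSet.univ, setLIntegral_univ,
    ← ofReal_integral_eq_lintegral_ofReal hi2 (.of_forall (tiltDens_nonneg h1 θ))]
  unfold tiltDens
  rw [integral_add (integrable_const _) (hi.const_mul _), integral_const_mul, h0]
  simp

/-- The path with densities `1 + θ s` with respect to `P`, for `θ` near `0`. -/
def tilt (P : ProbabilityMeasure X) (h0 : ∫ x, s x ∂(P : Measure X) = 0) (θ : ℝ) :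
    ProbabilityMeasure X :=
  ⟨densMeasure (P : Measure X) (tiltDens s θ), isProbabilityMeasure_tilt hs h1 P h0 θ⟩

theorem abs_sqrt_one_add_sub_le {x : ℝ} (hx : -1 ≤ x) : |√(1 + x) - 1 - x / 2| ≤ x ^ 2 / 2 := by
  have h := Real.sq_sqrt (show 0 ≤ 1 + x by linarith)
  have h0 := Real.sqrt_nonneg (1 + x)
  set r := √(1 + x)
  have hx' : x = r ^ 2 - 1 := by linarith
  have e : r - 1 - x / 2 = -((r - 1) ^ 2 / 2) := by rw [hx']; ring
  rw [e, abs_neg, abs_of_nonneg (by positivity), hx']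
  have : (r ^ 2 - 1) ^ 2 = (r - 1) ^ 2 * (r + 1) ^ 2 := by ring
  rw [this]
  have : 1 ≤ (r + 1) ^ 2 := by nlinarith
  nlinarith [sq_nonneg (r - 1)]

theorem isQMDPath_tilt (P : ProbabilityMeasure X) (h0 : ∫ x, s x ∂(P : Measure X) = 0) :
    IsQMDPath P (tilt hs h1 P h0) s where
  at_zero := by
    apply Subtype.ext
    change densMeasure (P : Measure X) (tiltDens s 0) = P
    simp [densMeasure, tiltDens_zero]
  score_memLp := MemLp.of_bound hs.aestronglyMeasurable 1 (.of_forall h1)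
  differentiable := by
    refine ⟨P, inferInstance, tiltDens s, measurable_tiltDens hs, tiltDens_nonneg h1,
      fun _ => rfl, ?_⟩
    have hlim : Tendsto (fun θ : ℝ => ENNReal.ofReal |θ|) (𝓝[≠] 0) (𝓝 0) := by
      have : Tendsto (fun θ : ℝ => ENNReal.ofReal |θ|) (𝓝 0) (𝓝 (ENNReal.ofReal |0|)) :=
        ENNReal.tendsto_ofReal (continuous_abs.tendsto 0)
      simpa using this.mono_left nhdsWithin_le_nhds
    refine tendsto_of_tendsto_of_tendsto_of_le_of_le' tendsto_const_nhds hlim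
      (.of_forall fun _ => zero_le) ?_
    have hsmall : ∀ᶠ θ : ℝ in 𝓝[≠] 0, |θ| ≤ 1 / 2 := by
      refine nhdsWithin_le_nhds ?_
      have := (continuous_abs.tendsto (0 : ℝ)).eventually_lt_const
        (show |(0 : ℝ)| < 1 / 2 by norm_num)
      filter_upwards [this] with θ hθ using hθ.le
    filter_upwards [hsmall, self_mem_nhdsWithin] with θ hθ hθ0
    have hθ0 : θ ≠ 0 := hθ0
    refine (eLpNorm_le_of_ae_bound (C := |θ|) (.of_forall fun x => ?_)).trans_eq (by simp)
    rw [tiltDens_zero]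
    have hb := abs_clip_mul_le h1 θ x
    simp only [tiltDens, if_pos hθ] at hb ⊢
    have h := abs_sqrt_one_add_sub_le (x := θ * s x) (by linarith [(abs_le.1 hb).1])
    have e : (√(1 + θ * s x) - √1) / θ - s x * √1 / 2 =
        (√(1 + θ * s x) - 1 - θ * s x / 2) / θ := by
      rw [Real.sqrt_one]; field_simp
    rw [e, norm_div, Real.norm_eq_abs, Real.norm_eq_abs, div_le_iff₀ (abs_pos.2 hθ0)]
    refine h.trans ?_
    have hs1 : s x ^ 2 ≤ 1 := (sq_le_one_iff_abs_le_one _).2 (h1 x)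
    rw [← abs_mul, abs_mul_self, mul_pow]
    nlinarith [sq_nonneg θ, sq_nonneg (s x)]

end Tilt

section IndicatorScore

variable {X : Type*} [MeasurableSpace X] (P : ProbabilityMeasure X) (S : Set X)

/-- The score `1_S - P(S)`. -/
def indicatorScore (x : X) : ℝ := S.indicator (fun _ => 1) x - (P : Measure X).real S

variable {P S}

theorem measurable_indicatorScore (hS : MeasurableSet S) : Measurable (indicatorScore P S) :=
  (measurable_const.indicator hS).sub measurable_const

theorem abs_indicatorScore_le (x : X) : |indicatorScore P S x| ≤ 1 := by
  have h1 : (P : Measure X).real S ≤ 1 := measureReal_le_one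
  have h0 : 0 ≤ (P : Measure X).real S := measureReal_nonneg
  unfold indicatorScore
  by_cases hx : x ∈ S <;> simp only [hx, Set.indicator_of_mem, Set.indicator_of_notMem,
    not_false_eq_true] <;> rw [abs_le] <;> constructor <;> linarith

theorem integral_mul_indicatorScore (hS : MeasurableSet S) {D : X → ℝ}
    (hD : Integrable D (P : Measure X)) :
    ∫ x, D x * indicatorScore P S x ∂(P : Measure X) =
      ∫ x in S, D x ∂(P : Measure X) -
        (P : Measure X).real S * ∫ x, D x ∂(P : Measure X) := by
  have e : ∀ x, D x * indicatorScore P S x =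
      S.indicator D x - (P : Measure X).real S * D x := fun x => by
    unfold indicatorScore; by_cases hx : x ∈ S <;> simp [hx] <;> ring
  simp_rw [e]
  rw [integral_sub (hD.indicator hS) (hD.const_mul _), integral_indicator hS,
    integral_const_mul]

theorem integral_indicatorScore (hS : MeasurableSet S) :
    ∫ x, indicatorScore P S x ∂(P : Measure X) = 0 := by
  have := integral_mul_indicatorScore (P := P) hS (integrable_const (1 : ℝ))
  simpa using this

/-- A function orthogonal to all centred indicators is constant. -/
theorem ae_eq_integral_of_forall_indicatorScore {D : X → ℝ} (hD : Integrable D (P : Measure X))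
    (h : ∀ S, MeasurableSet S → ∫ x, D x * indicatorScore P S x ∂(P : Measure X) = 0) :
    D =ᵐ[(P : Measure X)] fun _ => ∫ x, D x ∂(P : Measure X) := by
  refine hD.ae_eq_of_forall_setIntegral_eq _ _ (integrable_const _) fun S hS _ => ?_
  have := h S hS
  rw [integral_mul_indicatorScore hS hD] at this
  rw [setIntegral_const, smul_eq_mul]
  linarith

/-- If the centred indicators are scores, the tangent space contains every mean-zero
square-integrable function. -/
theorem toLp_mem_tangentSpace {Sub : (ℝ → ProbabilityMeasure X) → (X → ℝ) → Prop}
    (hSub : ∀ S, MeasurableSet S → ∃ Pt, Sub Pt (indicatorScore P S)) {φ : X → ℝ}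
    (hφ : MemLp φ 2 (P : Measure X)) (h0 : ∫ x, φ x ∂(P : Measure X) = 0) :
    hφ.toLp φ ∈ tangentSpace P Sub := by
  rw [tangentSpace, ← Submodule.orthogonal_orthogonal_eq_closure, Submodule.mem_orthogonal]
  intro D hD
  rw [Submodule.mem_orthogonal] at hD
  have hDi : Integrable D (P : Measure X) := (Lp.memLp D).integrable (by norm_num)
  have hDc := ae_eq_integral_of_forall_indicatorScore hDi fun S hS => by
    obtain ⟨Pt, hPt⟩ := hSub S hS
    have hm : MemLp (indicatorScore P S) 2 (P : Measure X) :=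
      MemLp.of_bound (measurable_indicatorScore hS).aestronglyMeasurable 1
        (.of_forall abs_indicatorScore_le)
    have := hD (hm.toLp _) (Submodule.subset_span ⟨Pt, _, hPt, hm.coeFn_toLp⟩)
    rw [L2.inner_def] at this
    rw [← this]
    refine integral_congr_ae ?_
    filter_upwards [hm.coeFn_toLp] with x hx
    rw [hx]
    simp [mul_comm]
  rw [L2.inner_def]
  have e : ∫ x, inner ℝ (D x) (hφ.toLp φ x) ∂(P : Measure X) =
      ∫ x, (∫ y, D y ∂(P : Measure X)) * φ x ∂(P : Measure X) := by
    refine integral_congr_ae ?_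
    filter_upwards [hDc, hφ.coeFn_toLp] with x h1 h2
    rw [h2, h1]
    simp [mul_comm]
  rw [e, integral_const_mul, h0, mul_zero]

/-- If the centred indicators are scores, influence functions are unique. -/
theorem IsInfluenceFunction.ae_eq {Sub : (ℝ → ProbabilityMeasure X) → (X → ℝ) → Prop}
    (hSub : ∀ S, MeasurableSet S → ∃ Pt, Sub Pt (indicatorScore P S))
    {Ψ : ProbabilityMeasure X → ℝ} {φ φ' : X → ℝ} (h : IsInfluenceFunction P Sub Ψ φ)
    (h' : IsInfluenceFunction P Sub Ψ φ') : φ =ᵐ[(P : Measure X)] φ' := by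
  have i := h.memLp.integrable (by norm_num)
  have i' := h'.memLp.integrable (by norm_num)
  have hD := ae_eq_integral_of_forall_indicatorScore (i.sub i') fun S hS => by
    obtain ⟨Pt, hPt⟩ := hSub S hS
    have hm : MemLp (indicatorScore P S) 2 (P : Measure X) :=
      MemLp.of_bound (measurable_indicatorScore hS).aestronglyMeasurable 1
        (.of_forall abs_indicatorScore_le)
    have e := (h.hasDerivAt Pt _ hPt).unique (h'.hasDerivAt Pt _ hPt)
    have j : Integrable (fun x => φ x * indicatorScore P S x) (P : Measure X) :=
      h.memLp.integrable_mul hm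
    have j' : Integrable (fun x => φ' x * indicatorScore P S x) (P : Measure X) :=
      h'.memLp.integrable_mul hm
    simp_rw [Pi.sub_apply, sub_mul]
    rw [integral_sub j j', e, sub_self]
  have h0 : ∫ x, (φ - φ') x ∂(P : Measure X) = 0 := by
    rw [integral_sub' i i', h.mean_zero, h'.mean_zero, sub_zero]
  filter_upwards [hD] with x hx
  rw [h0, Pi.sub_apply] at hx
  linarith

end IndicatorScore

end Semiparametric

namespace IV

open Semiparametric

section Submodel

variable {𝒵 : Type*} {𝒴 : Set ℝ} {𝓛 : Type*} [MeasurableSpace 𝒵] [MeasurableSpace 𝓛]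
  [StandardBorelSpace 𝒵] [Nonempty 𝒵] [StandardBorelSpace 𝒴] [Nonempty 𝒴]
  [StandardBorelSpace 𝓛] [Nonempty 𝓛] {π : 𝒵 → 𝓛 → ℝ}
  {P : ProbabilityMeasure (Obs 𝒵 𝒴 𝓛)} {s : Obs 𝒵 𝒴 𝓛 → ℝ} (hs : Measurable s)
  (h1 : ∀ x, |s x| ≤ 1) (h0 : ∫ x, s x ∂(P : Measure (Obs 𝒵 𝒴 𝓛)) = 0)

theorem integral_mul_condMean_tilt_sub_le {f : Obs 𝒵 𝒴 𝓛 → ℝ} (hf : Measurable f) {C : ℝ}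
    (hC : ∀ o, |f o| ≤ C) {g : 𝓛 → ℝ} (hg : Measurable g) (hg1 : ∀ l, |g l| ≤ 1) (θ : ℝ) :
    ∫ o, g o.L * (condMean (tilt hs h1 P h0 θ) f o.L - condMean P f o.L)
        ∂(P : Measure (Obs 𝒵 𝒴 𝓛)) ≤
      2 * C * |θ| * ∫ o : Obs 𝒵 𝒴 𝓛, |g o.L| ∂(P : Measure (Obs 𝒵 𝒴 𝓛)) := by
  set Q := tilt hs h1 P h0 θ with hQ
  have mQ := measurable_condMean Q hf
  have hQC : ∀ l, |condMean Q f l| ≤ C := abs_condMean_le Q hC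
  have e1 := integral_mul_condMean_sub P hf hC hg hg1 mQ hQC
  have e2 := integral_mul_condMean_sub Q hf hC hg hg1 mQ hQC
  simp only [sub_self, mul_zero, integral_zero] at e2
  rw [e1]
  have hdens : (Q : Measure (Obs 𝒵 𝒴 𝓛)) =
    densMeasure (P : Measure (Obs 𝒵 𝒴 𝓛)) (tiltDens s θ) := rfl
  rw [hdens, integral_densMeasure (measurable_tiltDens hs θ) (tiltDens_nonneg h1 θ)] at e2
  set h : Obs 𝒵 𝒴 𝓛 → ℝ := fun o => g o.L * (condMean Q f o.L - f o) with hh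
  have mh : Measurable h := by fun_prop
  have hb : ∀ o, |h o| ≤ 2 * C * |g o.L| := fun o => by
    rw [hh]; simp only
    rw [abs_mul, mul_comm]
    refine mul_le_mul_of_nonneg_right ((abs_sub _ _).trans ?_) (abs_nonneg _)
    linarith [hQC o.L, hC o]
  have hgi : Integrable (fun o : Obs 𝒵 𝒴 𝓛 => |g o.L|) (P : Measure (Obs 𝒵 𝒴 𝓛)) :=
    Integrable.of_bound (hg.comp Obs.measurable_L).abs.aestronglyMeasurable 1
      (.of_forall fun o => by simpa using hg1 o.L)
  have hi : Integrable h (P : Measure (Obs 𝒵 𝒴 𝓛)) :=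
    (hgi.const_mul (2 * C)).mono' mh.aestronglyMeasurable (.of_forall hb)
  have hi2 : Integrable (fun o => h o * tiltDens s θ o) (P : Measure (Obs 𝒵 𝒴 𝓛)) := by
    refine hi.mul_bdd (c := 4) (measurable_tiltDens hs θ).aestronglyMeasurable
      (.of_forall fun o => ?_)
    rw [Real.norm_of_nonneg (tiltDens_nonneg h1 θ o)]
    exact tiltDens_le h1 θ o
  have e3 : ∫ o, h o ∂(P : Measure (Obs 𝒵 𝒴 𝓛)) =
      ∫ o, (h o - h o * tiltDens s θ o) ∂(P : Measure (Obs 𝒵 𝒴 𝓛)) := by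
    rw [integral_sub hi hi2, ← e2, sub_zero]
  change ∫ o, h o ∂(P : Measure (Obs 𝒵 𝒴 𝓛)) ≤ _
  rw [e3, ← integral_const_mul]
  refine integral_mono (hi.sub hi2) (hgi.const_mul _) fun o => ?_
  have e4 : h o - h o * tiltDens s θ o = -(h o * ((if |θ| ≤ 1 / 2 then θ else 0) * s o)) := by
    unfold tiltDens; ring
  simp only
  rw [e4]
  refine (neg_le_abs _).trans ?_
  have hθ : |(if |θ| ≤ 1 / 2 then θ else 0)| ≤ |θ| := by split_ifs <;> simp
  rw [abs_mul, abs_mul (if |θ| ≤ 1 / 2 then θ else 0)]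
  calc _ ≤ 2 * C * |g o.L| * (|θ| * 1) := by
        have := (abs_nonneg _).trans (hb o)
        exact mul_le_mul (hb o) (mul_le_mul hθ (h1 o) (abs_nonneg _) (abs_nonneg _))
          (by positivity) this
    _ = _ := by ring

theorem ae_abs_condMean_tilt_sub_le {f : Obs 𝒵 𝒴 𝓛 → ℝ} (hf : Measurable f) {C : ℝ}
    (hC : ∀ o, |f o| ≤ C) (θ : ℝ) :
    ∀ᵐ l ∂(lawL P), |condMean (tilt hs h1 P h0 θ) f l - condMean P f l| ≤ 2 * C * |θ| := by
  have mQ := measurable_condMean (tilt hs h1 P h0 θ) hf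
  have mP := measurable_condMean P hf
  have hi : Integrable (fun l => condMean (tilt hs h1 P h0 θ) f l - condMean P f l)
      (lawL P) := by
    refine Integrable.of_bound (by fun_prop) (C + C) (.of_forall fun l => ?_)
    exact (abs_sub _ _).trans (add_le_add (abs_condMean_le _ hC _) (abs_condMean_le P hC _))
  have key : ∀ c : ℝ, |c| = 1 → ∀ᵐ l ∂(lawL P),
      c * (condMean (tilt hs h1 P h0 θ) f l - condMean P f l) ≤ 2 * C * |θ| := fun c hc => by
    refine ae_le_of_forall_setIntegral_le (hi.const_mul c) (integrable_const _) fun G hG _ => ?_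
    have mg : Measurable (G.indicator fun _ : 𝓛 => c) := measurable_const.indicator hG
    have habs : ∀ l, |G.indicator (fun _ : 𝓛 => c) l| = G.indicator (fun _ => 1) l := fun l => by
      by_cases hl : l ∈ G <;> simp [hl, hc]
    have h := integral_mul_condMean_tilt_sub_le hs h1 h0 hf hC mg
      (fun l => by rw [habs]; exact Set.indicator_le_self' (fun _ _ => zero_le_one) l) θ
    simp_rw [habs] at h
    rw [← integral_lawL P (f := fun l => G.indicator (fun _ => c) l *
        (condMean (tilt hs h1 P h0 θ) f l - condMean P f l)) (by fun_prop),
      ← integral_lawL P (measurable_const.indicator hG), integral_indicator hG] at h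
    rw [setIntegral_const, smul_eq_mul, mul_comm]
    rw [setIntegral_const, smul_eq_mul, mul_one] at h
    refine le_of_eq_of_le ?_ h
    rw [← integral_indicator hG]
    refine integral_congr_ae (.of_forall fun l => ?_)
    by_cases hl : l ∈ G <;> simp [hl]
  filter_upwards [key 1 (by simp), key (-1) (by simp)] with l hl1 hl2
  rw [abs_le]; constructor <;> linarith

theorem isRegularSubmodel_tilt (hY : MemLp Obs.Y 2 (P : Measure (Obs 𝒵 𝒴 𝓛)))
    (hπ : IsRWF P π) : IsRegularSubmodel π P (tilt hs h1 P h0) s := by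
  obtain ⟨C, hC⟩ := hπ.bounded
  obtain ⟨ε, hε, hrP⟩ := hπ.relevance
  have hw := measurable_wt (𝒴 := 𝒴) hπ.measurable
  have hwC : ∀ o : Obs 𝒵 𝒴 𝓛, |wt π o| ≤ C := fun o => hC _ _
  have hle : ∀ θ, (tilt hs h1 P h0 θ : Measure (Obs 𝒵 𝒴 𝓛)) ≤
      (4 : ℝ≥0∞) • (P : Measure (Obs 𝒵 𝒴 𝓛)) := fun θ => by
    change densMeasure _ _ ≤ _
    rw [densMeasure, ← withDensity_const]
    refine withDensity_mono (.of_forall fun o => ?_)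
    refine (ENNReal.ofReal_le_ofReal (tiltDens_le h1 θ o)).trans_eq (by norm_num)
  have hfin : (4 : ℝ≥0∞) ^ (1 / (2 : ℝ≥0∞)).toReal *
      eLpNorm Obs.Y 2 (P : Measure (Obs 𝒵 𝒴 𝓛)) ≠ ∞ :=
    ENNReal.mul_ne_top (by simp) hY.2.ne
  refine ⟨isQMDPath_tilt hs h1 P h0, ENNReal.toNNReal ((4 : ℝ≥0∞) ^ (1 / (2 : ℝ≥0∞)).toReal *
    eLpNorm Obs.Y 2 (P : Measure (Obs 𝒵 𝒴 𝓛))), ε / 2, half_pos hε, ?_⟩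
  have hlim : Tendsto (fun θ : ℝ => 6 * C * |θ|) (𝓝 0) (𝓝 (6 * C * |0|)) :=
    (continuous_abs.tendsto 0).const_mul _
  filter_upwards [hlim.eventually_lt_const (show 6 * C * |0| < ε / 2 by simpa using hε)]
    with θ hθ
  refine ⟨?_, fun a => ?_⟩
  · rw [ENNReal.coe_toNNReal hfin]
    refine (eLpNorm_mono_measure _ (hle θ)).trans_eq ?_
    rw [eLpNorm_smul_measure_of_ne_top (by norm_num), smul_eq_mul]
  · have hac : lawL (tilt hs h1 P h0 θ) ≪ lawL P :=
      Measure.AbsolutelyContinuous.map (withDensity_absolutelyContinuous _ _)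
        Obs.measurable_L
    refine hac ?_
    have hpC : ∀ o : Obs 𝒵 𝒴 𝓛, |Obs.indA a o * wt π o| ≤ C := fun o => by
      rw [abs_mul, ← one_mul C]
      exact mul_le_mul (Obs.abs_indA_le a o) (hwC o) (abs_nonneg _) zero_le_one
    filter_upwards [hrP a, ae_abs_condMean_tilt_sub_le hs h1 h0 hw hwC θ,
      ae_abs_condMean_tilt_sub_le hs h1 h0 (Obs.measurable_indA a) (Obs.abs_indA_le a) θ,
      ae_abs_condMean_tilt_sub_le hs h1 h0 (f := fun o => Obs.indA a o * wt π o) (by fun_prop)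
        hpC θ] with l hl h2 h3 h4
    rw [condCov_A_wt _ hπ.measurable hC] at hl ⊢
    have hQ1 := abs_condMean_le (tilt hs h1 P h0 θ) (Obs.abs_indA_le a) l
    have hP1 := abs_condMean_le P hwC l
    set x1 := condMean (tilt hs h1 P h0 θ) (fun o => Obs.indA a o * wt π o) l
    set x0 := condMean P (fun o => Obs.indA a o * wt π o) l
    set a1 := condMean (tilt hs h1 P h0 θ) (Obs.indA a) l
    set a0 := condMean P (Obs.indA a) l
    set w1 := condMean (tilt hs h1 P h0 θ) (wt π) l
    set w0 := condMean P (wt π) l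
    have h5 : |a1 * (w1 - w0)| ≤ 1 * (2 * C * |θ|) := by
      rw [abs_mul]; exact mul_le_mul hQ1 h2 (abs_nonneg _) zero_le_one
    have h6 : |(a1 - a0) * w0| ≤ 2 * 1 * |θ| * C := by
      rw [abs_mul]; exact mul_le_mul h3 hP1 (abs_nonneg _) (by positivity)
    have e : x0 - a0 * w0 = (x1 - a1 * w1) - (x1 - x0) + a1 * (w1 - w0) + (a1 - a0) * w0 := by
      ring
    have h7 := abs_add_le ((x1 - a1 * w1) - (x1 - x0) + a1 * (w1 - w0)) ((a1 - a0) * w0)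
    have h8 := abs_add_le ((x1 - a1 * w1) - (x1 - x0)) (a1 * (w1 - w0))
    have h9 := abs_sub (x1 - a1 * w1) (x1 - x0)
    rw [e] at hl
    linarith

end Submodel

end IV

end

theorem mainTheorem5 {𝒵 : Type*} {𝒴 : Set ℝ} {𝓛 : Type*}
    [MeasurableSpace 𝒵] [StandardBorelSpace 𝒵] [Nonempty 𝒵]
    [StandardBorelSpace 𝒴] [Nonempty 𝒴]
    [MeasurableSpace 𝓛] [StandardBorelSpace 𝓛] [Nonempty 𝓛]
    (P : ProbabilityMeasure (IV.Obs 𝒵 𝒴 𝓛))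
    (hY : MemLp IV.Obs.Y 2 (P : Measure (IV.Obs 𝒵 𝒴 𝓛)))
    (π : 𝒵 → 𝓛 → ℝ) (hπ : IV.IsRWF P π) :
    Semiparametric.IsEfficientInfluenceFunction P (IV.IsRegularSubmodel π P) (IV.psi π)
        (IV.phi π (IV.psi π P) (IV.trueNuisance π P)) ∧
      ∀ φ : IV.Obs 𝒵 𝒴 𝓛 → ℝ,
        Semiparametric.IsInfluenceFunction P (IV.IsRegularSubmodel π P) (IV.psi π) φ →
          φ =ᵐ[(P : Measure (IV.Obs 𝒵 𝒴 𝓛))]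
            IV.phi π (IV.psi π P) (IV.trueNuisance π P) := by
  obtain ⟨C, hC⟩ := hπ.bounded
  obtain ⟨ε, hε, hrP⟩ := hπ.relevance
  have hφ : Semiparametric.IsInfluenceFunction P (IV.IsRegularSubmodel π P) (IV.psi π)
      (IV.phi π (IV.psi π P) (IV.trueNuisance π P)) :=
    { memLp := IV.memLp_phi P hε hπ.measurable hC hY hrP _
      mean_zero := IV.integral_phi P hε hπ.measurable hC hY hrP
      hasDerivAt := fun _ _ hs => IV.hasDerivAt_psi hY hπ hs }
  have hSub : ∀ S, MeasurableSet S → ∃ Pt,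
      IV.IsRegularSubmodel π P Pt (Semiparametric.indicatorScore P S) := fun S hS =>
    ⟨_, IV.isRegularSubmodel_tilt (Semiparametric.measurable_indicatorScore hS)
      Semiparametric.abs_indicatorScore_le (Semiparametric.integral_indicatorScore hS) hY hπ⟩
  exact ⟨⟨hφ, Semiparametric.toLp_mem_tangentSpace hSub hφ.memLp hφ.mean_zero⟩,
    fun φ h => h.ae_eq hSub hφ⟩
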